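/- Let $n\ge 2$ and let $U\subset\mathbb{R}^n=\mathbb{R}\times\mathbb{R}^{n-1}$, with coordinates $(t,u_1,\dots,u_{n-1})$, be a nonempty open subset such that the projection $p\colon U\to\mathbb{R}^{n-1}$, $(t,u)\mapsto u$, has connected fibers over the points of $p(U)$ and $p(U)$ is star-shaped with respect to $0\in\mathbb{R}^{n-1}$. Let $\mathfrak{X}^\bullet(U)$ be the algebra of smooth multivector fields on $U$ with the wedge product, let $E=\sum_{i=1}^{n-1}u_i\partial_{u_i}$ be the Euler field, let $\Lambda_{book}=\partial_t\wedge E$, and let $H^\bullet_{book}(U)=\bigoplus_k H^k_{book}(U)$ be the Poisson cohomology ring of $\Lambda_{book}$ on $U$, i.e. the cohomology of $\mathfrak{X}^\bullet(U)$ with the differential $d_{book}=[\Lambda_{book},\cdot\,]$ given by the Schouten bracket, with the product induced by the wedge product. Let $\wedge^\bullet\mathrm{span}_{\mathbb{R}}\{\partial_t,u_i\partial_{u_j}\}$ (with $1\le i,j\le n-1$) denote the real subalgebra of $\mathfrak{X}^\bullet(U)$ generated under the wedge product of multivector fields by $1$, $\partial_t$ and all $u_i\partial_{u_j}$; all its elements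 are $d_{book}$-closed. Then the natural ring homomorphism $$\wedge^\bullet\mathrm{span}_{\mathbb{R}}\{\partial_t,u_i\partial_{u_j}\}\longrightarrow H^\bullet_{book}(U),\qquad a\mapsto[a],$$ which preserves degrees, is onto (also in each degree $k$), and its kernel is the two-sided ideal $\langle E\rangle$ generated by $E$. Hence it induces a ring isomorphism $$\frac{\wedge^\bullet\mathrm{span}_{\mathbb{R}}\{\partial_t,u_i\partial_{u_j}\}}{\langle E\rangle}\;\xrightarrow{\ \sim\ }\;H^\bullet_{book}(U).$$ -/

import Mathlib

open TopologicalSpace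
open scoped ContDiff Manifold TensorProduct

noncomputable section

namespace BookPoisson

/-- Extension by zero of a function on an open set to the whole space. -/
def zeroExt {X : Type*} [TopologicalSpace X] {U : Opens X} (f : U → ℝ) : X → ℝ :=
  Function.extend Subtype.val f 0

theorem zeroExt_apply {X : Type*} [TopologicalSpace X] {U : Opens X} (f : U → ℝ) (x : U) :
    zeroExt f x = f x :=
  Subtype.val_injective.extend_apply _ _ x

theorem zeroExt_eventuallyEq {X : Type*} [TopologicalSpace X] {U : Opens X} {f : U → ℝ} {g : X → ℝ} (h : ∀ y : U, f y = g y)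
    (x : U) : zeroExt f =ᶠ[nhds (x : X)] g := by
  filter_upwards [U.isOpen.mem_nhds x.2] with y hy
  rw [zeroExt_apply f ⟨y, hy⟩, h]

section General

variable {F : Type*} [NormedAddCommGroup F] [NormedSpace ℝ F]

/-- The real algebra of smooth (`C^∞`) real functions on the open set `U`. -/
def smoothFunctions (U : Opens F) : Subalgebra ℝ (U → ℝ) where
  carrier := {f | ContMDiff 𝓘(ℝ, F) 𝓘(ℝ, ℝ) ∞ f}
  mul_mem' hf hg := ContMDiff.mul hf hg
  add_mem' hf hg := ContMDiff.add hf hg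
  algebraMap_mem' _ := contMDiff_const

/-- The commutative real algebra `C^∞(U)`. -/
def Smooth (U : Opens F) : Type _ := smoothFunctions U

instance (U : Opens F) : CommRing (Smooth U) := inferInstanceAs (CommRing (smoothFunctions U))

instance (U : Opens F) : Algebra ℝ (Smooth U) := inferInstanceAs (Algebra ℝ (smoothFunctions U))

theorem zeroExt_contDiffAt {U : Opens F} (f : Smooth U) (x : U) :
    ContDiffAt ℝ ∞ (zeroExt f.1) (x : F) := by
  rw [← contMDiffAt_iff_contDiffAt, ← contMDiffAt_subtype_iff]
  have h : (fun y : U => zeroExt f.1 y) = f.1 := funext (zeroExt_apply f.1)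
  rw [h]
  exact f.2 x

/-- The derivation `f ↦ ∂f/∂v` of `C^∞(U)`: directional derivative along the constant vector `v`.
Since `U` is open, the derivative at a point of `U` does not see the values outside `U`. -/
def dirDeriv (U : Opens F) (v : F) : Derivation ℝ (Smooth U) (Smooth U) :=
  Derivation.mk'
    { toFun := fun f => ⟨fun x => fderiv ℝ (zeroExt f.1) (x : F) v, fun x => by
        rw [contMDiffAt_subtype_iff (f := fun y : F => fderiv ℝ (zeroExt f.1) y v),
          contMDiffAt_iff_contDiffAt]
        exact ((zeroExt_contDiffAt f x).fderiv_right (m := ∞) (by simp)).clm_apply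
          contDiffAt_const⟩
      map_add' := fun f g => by
        refine Subtype.ext (funext fun x => ?_)
        have hf := (zeroExt_contDiffAt f x).differentiableAt (by simp)
        have hg := (zeroExt_contDiffAt g x).differentiableAt (by simp)
        have h : zeroExt (f.1 + g.1) =ᶠ[nhds (x : F)] zeroExt f.1 + zeroExt g.1 :=
          zeroExt_eventuallyEq (fun y => by simp [zeroExt_apply]) x
        change fderiv ℝ (zeroExt (f.1 + g.1)) (x : F) v
          = fderiv ℝ (zeroExt f.1) (x : F) v + fderiv ℝ (zeroExt g.1) (x : F) v
        rw [h.fderiv_eq, fderiv_add hf hg]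
        rfl
      map_smul' := fun c f => by
        refine Subtype.ext (funext fun x => ?_)
        have hf := (zeroExt_contDiffAt f x).differentiableAt (by simp)
        have h : zeroExt (c • f.1) =ᶠ[nhds (x : F)] c • zeroExt f.1 :=
          zeroExt_eventuallyEq (fun y => by simp [zeroExt_apply]) x
        change fderiv ℝ (zeroExt (c • f.1)) (x : F) v = c • fderiv ℝ (zeroExt f.1) (x : F) v
        rw [h.fderiv_eq, fderiv_const_smul hf]
        rfl }
    (fun f g => by
      refine Subtype.ext (funext fun x => ?_)
      have hf := (zeroExt_contDiffAt f x).differentiableAt (by simp)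
      have hg := (zeroExt_contDiffAt g x).differentiableAt (by simp)
      have h : zeroExt (f.1 * g.1) =ᶠ[nhds (x : F)] zeroExt f.1 * zeroExt g.1 :=
        zeroExt_eventuallyEq (fun y => by simp [zeroExt_apply]) x
      change fderiv ℝ (zeroExt (f.1 * g.1)) (x : F) v
        = f.1 x * fderiv ℝ (zeroExt g.1) (x : F) v + g.1 x * fderiv ℝ (zeroExt f.1) (x : F) v
      rw [h.fderiv_eq, fderiv_mul hf hg]
      simp [zeroExt_apply])

theorem dirDeriv_apply {U : Opens F} (v : F) (f : Smooth U) (x : U) :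
    (dirDeriv U v f).1 x = fderiv ℝ (zeroExt f.1) (x : F) v := rfl

/-- Multivector fields on an open subset `U` of a finite-dimensional real vector space `F`. The
tangent bundle of `U` is `U × F`, so the algebra of smooth sections of its exterior algebra is
`C^∞(U) ⊗ ⋀ F`, with `f ⊗ (v₁ ∧ ⋯ ∧ v_k)` the `k`-vector field `x ↦ f(x) v₁ ∧ ⋯ ∧ v_k`. The product
of this ring is the wedge product of multivector fields. -/
abbrev Multivector (U : Opens F) : Type _ := Smooth U ⊗[ℝ] ExteriorAlgebra ℝ F

/-- The space of `k`-vector fields on `U`, i.e. `C^∞(U) ⊗ ⋀^k F`. -/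
def multivectorsOfDegree (U : Opens F) (k : ℕ) : Submodule ℝ (Multivector U) :=
  LinearMap.range (LinearMap.lTensor (Smooth U) (⋀[ℝ]^k F).subtype)

/-- Derivative of the coefficient functions of a multivector field along a constant vector `v`. -/
def coeffDeriv (U : Opens F) (v : F) : Multivector U →ₗ[ℝ] Multivector U :=
  LinearMap.rTensor (ExteriorAlgebra ℝ F) (dirDeriv U v).toLinearMap

/-- Contraction of multivector fields from the left with a constant covector `θ`; it is the left
odd derivative, with `θ ⌋ (v ∧ a) = θ(v) a - v ∧ (θ ⌋ a)`. -/
def contractL (U : Opens F) (θ : Module.Dual ℝ F) : Multivector U →ₗ[ℝ] Multivector U :=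
  LinearMap.lTensor (Smooth U) (CliffordAlgebra.contractLeft θ)

/-- Contraction of multivector fields from the right with a constant covector `θ`; it is the right
odd derivative, with `(a ∧ v) ⌊ θ = θ(v) a - (a ⌊ θ) ∧ v`. -/
def contractR (U : Opens F) (θ : Module.Dual ℝ F) : Multivector U →ₗ[ℝ] Multivector U :=
  LinearMap.lTensor (Smooth U) (CliffordAlgebra.contractRight.flip θ)

/-- The Schouten bracket, by its coordinate formula. If `x_i` are the linear coordinates attached to
the basis `e` and `ξ_i = e_i = ∂/∂x_i` are seen as odd variables, then
`[P, Q] = ∑ i, (∂P/∂ξ_i) ∧ (∂Q/∂x_i) - (∂P/∂x_i) ∧ (∂Q/∂ξ_i)`,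
with the right odd derivative on `P` and the left one on `Q`. On vector fields it is the Lie
bracket, `[X, f] = X(f)`, and `[X ∧ Y, Q] = X ∧ [Y, Q] - Y ∧ [X, Q]`. -/
def schouten {ι : Type*} [Fintype ι] (e : Module.Basis ι ℝ F) {U : Opens F}
    (P Q : Multivector U) : Multivector U :=
  ∑ i, (contractR U (e.coord i) P * coeffDeriv U (e i) Q
    - coeffDeriv U (e i) P * contractL U (e.coord i) Q)

/-- The operator `d_Λ = [Λ, ·]`. -/
def poissonDiff {ι : Type*} [Fintype ι] (e : Module.Basis ι ℝ F) {U : Opens F}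
    (Λ : Multivector U) : Multivector U →ₗ[ℝ] Multivector U where
  toFun := schouten e Λ
  map_add' P Q := by
    simp only [schouten, map_add, mul_add, ← Finset.sum_add_distrib]
    exact Finset.sum_congr rfl fun i _ => by abel
  map_smul' c P := by
    simp only [schouten, map_smul, mul_smul_comm, Finset.smul_sum, smul_sub, RingHom.id_apply]

/-- The algebra automorphism that is `(-1)^k` on `k`-vector fields. -/
def parity (U : Opens F) : Multivector U →ₐ[ℝ] Multivector U :=
  Algebra.TensorProduct.map (AlgHom.id ℝ (Smooth U)) CliffordAlgebra.involute
theorem coeffDeriv_tmul {U : Opens F} (v : F) (f : Smooth U) (a : ExteriorAlgebra ℝ F) :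
    coeffDeriv U v (f ⊗ₜ a) = dirDeriv U v f ⊗ₜ a := rfl

theorem contractL_tmul {U : Opens F} (θ : Module.Dual ℝ F) (f : Smooth U)
    (a : ExteriorAlgebra ℝ F) :
    contractL U θ (f ⊗ₜ a) = f ⊗ₜ[ℝ] CliffordAlgebra.contractLeft θ a := rfl

theorem contractR_tmul {U : Opens F} (θ : Module.Dual ℝ F) (f : Smooth U)
    (a : ExteriorAlgebra ℝ F) :
    contractR U θ (f ⊗ₜ a) = f ⊗ₜ[ℝ] CliffordAlgebra.contractRight a θ := rfl

theorem parity_tmul {U : Opens F} (f : Smooth U) (a : ExteriorAlgebra ℝ F) :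
    parity U (f ⊗ₜ a) = f ⊗ₜ[ℝ] CliffordAlgebra.involute a := rfl

theorem coeffDeriv_mul {U : Opens F} (v : F) (x y : Multivector U) :
    coeffDeriv U v (x * y) = coeffDeriv U v x * y + x * coeffDeriv U v y := by
  induction x using TensorProduct.induction_on with
  | zero => simp
  | add x₁ x₂ h₁ h₂ => simp only [add_mul, map_add, h₁, h₂]; abel
  | tmul f a =>
    induction y using TensorProduct.induction_on with
    | zero => simp
    | add y₁ y₂ h₁ h₂ => simp only [mul_add, map_add, h₁, h₂]; abel
    | tmul g c =>
      simp only [Algebra.TensorProduct.tmul_mul_tmul, coeffDeriv_tmul, Derivation.leibniz,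
        TensorProduct.add_tmul, smul_eq_mul]
      rw [add_comm, mul_comm g]

theorem contractLeft_mul (θ : Module.Dual ℝ F) (a c : ExteriorAlgebra ℝ F) :
    CliffordAlgebra.contractLeft θ (a * c) = CliffordAlgebra.contractLeft θ a * c
      + CliffordAlgebra.involute a * CliffordAlgebra.contractLeft θ c := by
  induction a using CliffordAlgebra.left_induction with
  | algebraMap r =>
    rw [CliffordAlgebra.contractLeft_algebraMap_mul, CliffordAlgebra.contractLeft_algebraMap,
      AlgHom.commutes, zero_mul, zero_add]
  | add x y hx hy => simp only [add_mul, map_add, hx, hy]; abel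
  | ι_mul x v hx =>
    rw [mul_assoc, CliffordAlgebra.contractLeft_ι_mul, hx, CliffordAlgebra.contractLeft_ι_mul,
      map_mul, CliffordAlgebra.involute_ι]
    simp only [mul_add, sub_mul, smul_mul_assoc, neg_mul, mul_assoc]
    abel

theorem contractLeft_involute (θ : Module.Dual ℝ F) (a : ExteriorAlgebra ℝ F) :
    CliffordAlgebra.contractLeft θ (CliffordAlgebra.involute a)
      = -CliffordAlgebra.involute (CliffordAlgebra.contractLeft θ a) := by
  induction a using CliffordAlgebra.left_induction with
  | algebraMap r => simp
  | add x y hx hy => simp only [map_add, hx, hy]; abel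
  | ι_mul x v hx =>
    rw [map_mul, CliffordAlgebra.involute_ι, neg_mul, map_neg,
      CliffordAlgebra.contractLeft_ι_mul, CliffordAlgebra.contractLeft_ι_mul, hx, map_sub,
      map_smul, map_mul, CliffordAlgebra.involute_ι]
    simp

theorem contractL_mul {U : Opens F} (θ : Module.Dual ℝ F) (x y : Multivector U) :
    contractL U θ (x * y) = contractL U θ x * y + parity U x * contractL U θ y := by
  induction x using TensorProduct.induction_on with
  | zero => simp
  | add x₁ x₂ h₁ h₂ => simp only [add_mul, map_add, h₁, h₂]; abel
  | tmul f a =>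
    induction y using TensorProduct.induction_on with
    | zero => simp
    | add y₁ y₂ h₁ h₂ => simp only [mul_add, map_add, h₁, h₂]; abel
    | tmul g c =>
      simp only [Algebra.TensorProduct.tmul_mul_tmul, contractL_tmul, parity_tmul,
        contractLeft_mul, TensorProduct.tmul_add]

theorem contractL_parity {U : Opens F} (θ : Module.Dual ℝ F) (x : Multivector U) :
    contractL U θ (parity U x) = -parity U (contractL U θ x) := by
  induction x using TensorProduct.induction_on with
  | zero => simp
  | add x₁ x₂ h₁ h₂ => simp only [map_add, h₁, h₂]; abel
  | tmul f a =>
    rw [parity_tmul, contractL_tmul, contractLeft_involute, contractL_tmul, parity_tmul,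
      TensorProduct.tmul_neg]

theorem coeffDeriv_parity {U : Opens F} (v : F) (x : Multivector U) :
    coeffDeriv U v (parity U x) = parity U (coeffDeriv U v x) := by
  induction x using TensorProduct.induction_on with
  | zero => simp
  | add x₁ x₂ h₁ h₂ => simp only [map_add, h₁, h₂]
  | tmul f a => rfl

theorem bivector_induction {U : Opens F} {p : Multivector U → Prop}
    (hadd : ∀ x y, p x → p y → p (x + y)) (h0 : p 0)
    (hmul : ∀ (f : Smooth U) (v w : F), p (f ⊗ₜ (ExteriorAlgebra.ι ℝ v * ExteriorAlgebra.ι ℝ w)))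
    {Λ : Multivector U} (hΛ : Λ ∈ multivectorsOfDegree U 2) : p Λ := by
  obtain ⟨t, rfl⟩ := hΛ
  induction t using TensorProduct.induction_on with
  | zero => simpa using h0
  | add x y hx hy => rw [map_add]; exact hadd _ _ hx hy
  | tmul f a =>
    obtain ⟨a, ha⟩ := a
    rw [LinearMap.lTensor_tmul, Submodule.subtype_apply]
    dsimp only
    have ha' : a ∈ LinearMap.range (ExteriorAlgebra.ι ℝ (M := F))
      * LinearMap.range (ExteriorAlgebra.ι ℝ (M := F)) := by rw [← pow_two]; exact ha
    clear ha
    induction ha' using Submodule.mul_induction_on' with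
    | mem_mul_mem m hm n hn =>
      obtain ⟨v, rfl⟩ := hm
      obtain ⟨w, rfl⟩ := hn
      exact hmul f v w
    | add x _ y _ hx hy => rw [TensorProduct.tmul_add]; exact hadd _ _ hx hy

theorem ι_mul_involute (v : F) (a : ExteriorAlgebra ℝ F) :
    ExteriorAlgebra.ι ℝ v * a = CliffordAlgebra.involute a * ExteriorAlgebra.ι ℝ v := by
  induction a using CliffordAlgebra.left_induction with
  | algebraMap r => rw [AlgHom.commutes, Algebra.commutes]
  | add x y hx hy => rw [mul_add, map_add, add_mul, hx, hy]
  | ι_mul x w hx =>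
    have h : ExteriorAlgebra.ι ℝ v * ExteriorAlgebra.ι ℝ w
        = -(ExteriorAlgebra.ι ℝ w * ExteriorAlgebra.ι ℝ v) :=
      eq_neg_of_add_eq_zero_left (ExteriorAlgebra.ι_add_mul_swap v w)
    change _ * (ExteriorAlgebra.ι ℝ w * x) = _
    rw [← mul_assoc, h, neg_mul, mul_assoc, hx, map_mul, CliffordAlgebra.involute_ι, neg_mul,
      neg_mul, mul_assoc]

theorem vector_mul {U : Opens F} (f : Smooth U) (v : F) (x : Multivector U) :
    (f ⊗ₜ[ℝ] ExteriorAlgebra.ι ℝ v) * x = parity U x * (f ⊗ₜ[ℝ] ExteriorAlgebra.ι ℝ v) := by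
  induction x using TensorProduct.induction_on with
  | zero => simp
  | add x₁ x₂ h₁ h₂ => rw [mul_add, h₁, h₂, map_add, add_mul]
  | tmul g a =>
    rw [parity_tmul, Algebra.TensorProduct.tmul_mul_tmul, Algebra.TensorProduct.tmul_mul_tmul,
      ι_mul_involute, mul_comm]

theorem contractR_bivector_mul {U : Opens F} {Λ : Multivector U}
    (hΛ : Λ ∈ multivectorsOfDegree U 2) (θ : Module.Dual ℝ F) (x : Multivector U) :
    contractR U θ Λ * x = parity U x * contractR U θ Λ := by
  refine bivector_induction (p := fun Λ => contractR U θ Λ * x = parity U x * contractR U θ Λ) ?_ ?_ ?_ hΛ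
  · intro y z hy hz; rw [map_add, add_mul, mul_add, hy, hz]
  · simp
  · intro f v w
    have h : CliffordAlgebra.contractRight (ExteriorAlgebra.ι ℝ v * ExteriorAlgebra.ι ℝ w) θ
        = ExteriorAlgebra.ι ℝ (θ w • v - θ v • w) := by
      rw [CliffordAlgebra.contractRight_mul_ι, CliffordAlgebra.contractRight_ι, map_sub, map_smul,
        map_smul, ← Algebra.smul_def]
    rw [contractR_tmul, h, vector_mul]

theorem parity_contractR_bivector {U : Opens F} {Λ : Multivector U}
    (hΛ : Λ ∈ multivectorsOfDegree U 2) (θ : Module.Dual ℝ F) :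
    parity U (contractR U θ Λ) = -contractR U θ Λ := by
  refine bivector_induction (p := fun Λ => parity U (contractR U θ Λ) = -contractR U θ Λ) ?_ ?_ ?_ hΛ
  · intro y z hy hz; rw [map_add, map_add, hy, hz]; abel
  · simp
  · intro f v w
    have h : CliffordAlgebra.contractRight (ExteriorAlgebra.ι ℝ v * ExteriorAlgebra.ι ℝ w) θ
        = ExteriorAlgebra.ι ℝ (θ w • v - θ v • w) := by
      rw [CliffordAlgebra.contractRight_mul_ι, CliffordAlgebra.contractRight_ι, map_sub, map_smul,
        map_smul, ← Algebra.smul_def]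
    rw [contractR_tmul, h, parity_tmul, CliffordAlgebra.involute_ι, TensorProduct.tmul_neg]

theorem coeffDeriv_bivector_mul {U : Opens F} {Λ : Multivector U}
    (hΛ : Λ ∈ multivectorsOfDegree U 2) (u : F) (x : Multivector U) :
    coeffDeriv U u Λ * x = x * coeffDeriv U u Λ := by
  refine bivector_induction (p := fun Λ => coeffDeriv U u Λ * x = x * coeffDeriv U u Λ) ?_ ?_ ?_ hΛ
  · intro y z hy hz; rw [map_add, add_mul, mul_add, hy, hz]
  · simp
  · intro f v w
    have h : (dirDeriv U u f) ⊗ₜ[ℝ] (ExteriorAlgebra.ι ℝ v * ExteriorAlgebra.ι ℝ w)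
        = ((dirDeriv U u f) ⊗ₜ[ℝ] ExteriorAlgebra.ι ℝ v)
          * ((1 : Smooth U) ⊗ₜ[ℝ] ExteriorAlgebra.ι ℝ w) := by
      rw [Algebra.TensorProduct.tmul_mul_tmul, mul_one]
    have hp : parity U (parity U x) = x := by
      induction x using TensorProduct.induction_on with
      | zero => simp
      | add x₁ x₂ h₁ h₂ => rw [map_add, map_add, h₁, h₂]
      | tmul g a => rw [parity_tmul, parity_tmul, CliffordAlgebra.involute_involute]
    rw [coeffDeriv_tmul, h, mul_assoc, vector_mul _ w, ← mul_assoc, vector_mul, hp, mul_assoc]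

theorem parity_coeffDeriv_bivector {U : Opens F} {Λ : Multivector U}
    (hΛ : Λ ∈ multivectorsOfDegree U 2) (u : F) :
    parity U (coeffDeriv U u Λ) = coeffDeriv U u Λ := by
  refine bivector_induction (p := fun Λ => parity U (coeffDeriv U u Λ) = coeffDeriv U u Λ) ?_ ?_ ?_ hΛ
  · intro y z hy hz; rw [map_add, map_add, hy, hz]
  · simp
  · intro f v w; rw [coeffDeriv_tmul, parity_tmul, map_mul]; simp

variable {ι : Type*} [Fintype ι]

theorem poissonDiff_mul (e : Module.Basis ι ℝ F) {U : Opens F} {Λ : Multivector U}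
    (hΛ : Λ ∈ multivectorsOfDegree U 2) (x y : Multivector U) :
    poissonDiff e Λ (x * y) = poissonDiff e Λ x * y + parity U x * poissonDiff e Λ y := by
  change schouten e Λ (x * y) = schouten e Λ x * y + parity U x * schouten e Λ y
  simp only [schouten, Finset.sum_mul, Finset.mul_sum, ← Finset.sum_add_distrib]
  refine Finset.sum_congr rfl fun i _ => ?_
  rw [coeffDeriv_mul, contractL_mul, mul_add, mul_add, ← mul_assoc _ x,
    contractR_bivector_mul hΛ _ x, ← mul_assoc _ (parity U x),
    coeffDeriv_bivector_mul hΛ _ (parity U x)]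
  simp only [sub_mul, mul_sub, mul_assoc]
  abel

theorem poissonDiff_parity (e : Module.Basis ι ℝ F) {U : Opens F} {Λ : Multivector U}
    (hΛ : Λ ∈ multivectorsOfDegree U 2) (x : Multivector U) :
    poissonDiff e Λ (parity U x) = -parity U (poissonDiff e Λ x) := by
  change schouten e Λ (parity U x) = -parity U (schouten e Λ x)
  simp only [schouten, map_sum, ← Finset.sum_neg_distrib, map_sub, map_mul,
    parity_contractR_bivector hΛ, parity_coeffDeriv_bivector hΛ, coeffDeriv_parity,
    contractL_parity]
  refine Finset.sum_congr rfl fun i _ => ?_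
  simp only [neg_mul, mul_neg, neg_sub, sub_neg_eq_add]
  abel

theorem poissonDiff_one (e : Module.Basis ι ℝ F) {U : Opens F} (Λ : Multivector U) :
    poissonDiff e Λ 1 = 0 := by
  change schouten e Λ 1 = 0
  refine Finset.sum_eq_zero fun i _ => ?_
  rw [Algebra.TensorProduct.one_def, coeffDeriv_tmul, contractL_tmul, Derivation.map_one_eq_zero,
    CliffordAlgebra.contractLeft_one]
  simp

/-- The kernel of `d_Λ`, for a bivector field `Λ`; as `d_Λ` is a graded derivation, it is a
subalgebra of the algebra of multivector fields. -/
def closedMultivectors (e : Module.Basis ι ℝ F) {U : Opens F} {Λ : Multivector U}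
    (hΛ : Λ ∈ multivectorsOfDegree U 2) : Subalgebra ℝ (Multivector U) where
  carrier := {x | poissonDiff e Λ x = 0}
  mul_mem' := by
    intro x y hx hy
    change poissonDiff e Λ (x * y) = 0
    rw [poissonDiff_mul e hΛ, hx, hy, zero_mul, mul_zero, add_zero]
  add_mem' := by
    intro x y hx hy
    change poissonDiff e Λ (x + y) = 0
    rw [map_add, hx, hy, add_zero]
  algebraMap_mem' := by
    intro r
    change poissonDiff e Λ (algebraMap ℝ _ r) = 0
    rw [Algebra.algebraMap_eq_smul_one, map_smul, poissonDiff_one, smul_zero]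

/-- The image of `d_Λ` in the algebra of closed multivector fields; it is a two-sided ideal. -/
def exactMultivectors (e : Module.Basis ι ℝ F) {U : Opens F} {Λ : Multivector U}
    (hΛ : Λ ∈ multivectorsOfDegree U 2) : Ideal (closedMultivectors e hΛ) where
  carrier := {x | ∃ y, poissonDiff e Λ y = x}
  add_mem' := by
    rintro _ _ ⟨y, hy⟩ ⟨z, hz⟩
    exact ⟨y + z, by rw [map_add, hy, hz]; rfl⟩
  zero_mem' := ⟨0, map_zero _⟩
  smul_mem' := by
    rintro ⟨c, hc⟩ x ⟨y, hy⟩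
    have hc' : poissonDiff e Λ c = 0 := hc
    refine ⟨parity U c * y, ?_⟩
    have hp : parity U (parity U c) = c := by
      clear hc hc' hy
      induction c using TensorProduct.induction_on with
      | zero => simp
      | add x₁ x₂ h₁ h₂ => rw [map_add, map_add, h₁, h₂]
      | tmul g a => rw [parity_tmul, parity_tmul, CliffordAlgebra.involute_involute]
    rw [poissonDiff_mul e hΛ, poissonDiff_parity e hΛ, hc', hp, hy]
    simp

instance (e : Module.Basis ι ℝ F) {U : Opens F} {Λ : Multivector U}
    (hΛ : Λ ∈ multivectorsOfDegree U 2) : (exactMultivectors e hΛ).IsTwoSided where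
  mul_mem_of_left := by
    rintro x ⟨c, hc⟩ ⟨y, hy⟩
    have hc' : poissonDiff e Λ c = 0 := hc
    refine ⟨y * c, ?_⟩
    rw [poissonDiff_mul e hΛ, hc', hy]
    simp

/-- The ring `ker d_Λ / im d_Λ`, the total Poisson cohomology of a Poisson bivector field `Λ` with
the product induced by the wedge product. -/
abbrev PoissonCohomology (e : Module.Basis ι ℝ F) {U : Opens F} {Λ : Multivector U}
    (hΛ : Λ ∈ multivectorsOfDegree U 2) : Type _ :=
  closedMultivectors e hΛ ⧸ exactMultivectors e hΛ

end General

theorem dirDeriv_comm {F : Type*} [NormedAddCommGroup F] [NormedSpace ℝ F] {U : Opens F} (v w : F)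
    (f : Smooth U) : dirDeriv U v (dirDeriv U w f) = dirDeriv U w (dirDeriv U v f) := by
  have key : ∀ (v w : F) (x : U), (dirDeriv U v (dirDeriv U w f)).1 x
      = fderiv ℝ (fderiv ℝ (zeroExt f.1)) (x : F) v w := by
    intro v w x
    have h : zeroExt (dirDeriv U w f).1 =ᶠ[nhds (x : F)] fun y => fderiv ℝ (zeroExt f.1) y w :=
      zeroExt_eventuallyEq (fun y => dirDeriv_apply w f y) x
    have hd : DifferentiableAt ℝ (fderiv ℝ (zeroExt f.1)) (x : F) :=
      ((zeroExt_contDiffAt f x).fderiv_right (m := ∞) (by simp)).differentiableAt (by simp)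
    rw [dirDeriv_apply, h.fderiv_eq, fderiv_clm_apply hd (differentiableAt_const w)]
    simp
  refine Subtype.ext (funext fun x => ?_)
  rw [key, key]
  exact ((zeroExt_contDiffAt f x).isSymmSndFDerivAt
    (by simp only [minSmoothness_of_isRCLikeNormedField]; exact WithTop.coe_le_coe.mpr (OrderTop.le_top (2 : ℕ∞)))).eq v w

section Book

variable {m : ℕ}

/-- The basis `∂_t, ∂_{u_1}, …, ∂_{u_m}` of `ℝ × ℝ^m`. -/
def coordBasis (m : ℕ) : Module.Basis (Unit ⊕ Fin m) ℝ (ℝ × (Fin m → ℝ)) :=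
  (Module.Basis.singleton Unit ℝ).prod (Pi.basisFun ℝ (Fin m))

theorem coordBasis_inl (i : Unit) : coordBasis m (Sum.inl i) = (1, 0) := by
  simp [coordBasis]

theorem coordBasis_inr (j : Fin m) : coordBasis m (Sum.inr j) = (0, Pi.single j 1) := by
  simp [coordBasis]

theorem coordBasis_coord_inl (i : Unit) (v : ℝ × (Fin m → ℝ)) :
    (coordBasis m).coord (Sum.inl i) v = v.1 := by
  simp [coordBasis]

theorem coordBasis_coord_inr (j : Fin m) (v : ℝ × (Fin m → ℝ)) :
    (coordBasis m).coord (Sum.inr j) v = v.2 j := by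
  simp [coordBasis]

variable (U : Opens (ℝ × (Fin m → ℝ)))

/-- The coordinate function `u_i` on `U`. -/
def uCoord (i : Fin m) : Smooth U :=
  ⟨fun x => (x : ℝ × (Fin m → ℝ)).2 i, fun x => by
    rw [contMDiffAt_subtype_iff (f := fun y : ℝ × (Fin m → ℝ) => y.2 i),
      contMDiffAt_iff_contDiffAt]
    fun_prop⟩

/-- The vector field `∂_t`. -/
def partialT : Multivector U := 1 ⊗ₜ ExteriorAlgebra.ι ℝ (1, 0)

/-- The vector field `∂_{u_j}`. -/
def partialU (j : Fin m) : Multivector U := 1 ⊗ₜ ExteriorAlgebra.ι ℝ (0, Pi.single j 1)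

/-- The vector field `u_i ∂_{u_j}`. -/
def linearField (i j : Fin m) : Multivector U := uCoord U i • partialU U j

/-- The Euler vector field `E = ∑ i, u_i ∂_{u_i}`. -/
def eulerField : Multivector U := ∑ i, linearField U i i

/-- The book Poisson structure `∂_t ∧ E`. -/
def bookBivector : Multivector U := partialT U * eulerField U

theorem linearField_eq (i j : Fin m) :
    linearField U i j = uCoord U i ⊗ₜ ExteriorAlgebra.ι ℝ (0, Pi.single j 1) := by
  rw [linearField, partialU, TensorProduct.smul_tmul', smul_eq_mul, mul_one]

theorem bookBivector_eq : bookBivector U = ∑ i, uCoord U i ⊗ₜ[ℝ]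
    (ExteriorAlgebra.ι ℝ (1, 0) * ExteriorAlgebra.ι ℝ (0, Pi.single i 1)) := by
  simp only [bookBivector, eulerField, Finset.mul_sum, linearField_eq, partialT,
    Algebra.TensorProduct.tmul_mul_tmul, one_mul]

theorem bookBivector_mem : bookBivector U ∈ multivectorsOfDegree U 2 := by
  rw [bookBivector_eq]
  refine Submodule.sum_mem _ fun i _ => ?_
  refine ⟨uCoord U i ⊗ₜ ⟨ExteriorAlgebra.ι ℝ (1, 0) * ExteriorAlgebra.ι ℝ (0, Pi.single i 1), ?_⟩,
    rfl⟩
  change _ ∈ LinearMap.range (ExteriorAlgebra.ι ℝ) ^ 2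
  rw [pow_two]
  exact Submodule.mul_mem_mul ⟨_, rfl⟩ ⟨_, rfl⟩

theorem dirDeriv_uCoord (v : ℝ × (Fin m → ℝ)) (i : Fin m) :
    dirDeriv U v (uCoord U i) = algebraMap ℝ (Smooth U) (v.2 i) := by
  refine Subtype.ext (funext fun x => ?_)
  have h : zeroExt (uCoord U i).1 =ᶠ[nhds (x : ℝ × (Fin m → ℝ))]
      ((ContinuousLinearMap.proj i).comp (ContinuousLinearMap.snd ℝ ℝ (Fin m → ℝ)) :
        ℝ × (Fin m → ℝ) →L[ℝ] ℝ) := zeroExt_eventuallyEq (f := (uCoord U i).1) (fun y => rfl) x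
  rw [dirDeriv_apply, h.fderiv_eq, ContinuousLinearMap.fderiv]
  rfl

/-- The Poisson differential of the book Poisson structure. -/
abbrev bookDiff : Multivector U →ₗ[ℝ] Multivector U :=
  poissonDiff (coordBasis m) (bookBivector U)

/-- The Lie derivative along the Euler field, in coordinates. -/
def lieEuler : Multivector U →ₗ[ℝ] Multivector U :=
  ∑ i, (LinearMap.mulLeft ℝ (uCoord U i ⊗ₜ[ℝ] 1) ∘ₗ coeffDeriv U (0, Pi.single i 1)
    - LinearMap.mulLeft ℝ (partialU U i) ∘ₗ contractL U ((coordBasis m).coord (Sum.inr i)))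

theorem coeffDeriv_book_inl : coeffDeriv U (1, 0) (bookBivector U) = 0 := by
  rw [bookBivector_eq, map_sum]
  refine Finset.sum_eq_zero fun i _ => ?_
  rw [coeffDeriv_tmul, dirDeriv_uCoord]
  simp

theorem coeffDeriv_book_inr (j : Fin m) :
    coeffDeriv U (0, Pi.single j 1) (bookBivector U) = partialT U * partialU U j := by
  rw [bookBivector_eq, map_sum, Finset.sum_eq_single j]
  · rw [coeffDeriv_tmul, dirDeriv_uCoord]
    simp [partialT, partialU]
  · intro i _ hij
    rw [coeffDeriv_tmul, dirDeriv_uCoord]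
    simp [hij]
  · simp

theorem contractRight_ι_mul_ι {V : Type*} [AddCommGroup V] [Module ℝ V] (θ : Module.Dual ℝ V)
    (v w : V) :
    CliffordAlgebra.contractRight (ExteriorAlgebra.ι ℝ v * ExteriorAlgebra.ι ℝ w) θ
      = θ w • ExteriorAlgebra.ι ℝ v - θ v • ExteriorAlgebra.ι ℝ w := by
  rw [CliffordAlgebra.contractRight_mul_ι, CliffordAlgebra.contractRight_ι, ← Algebra.smul_def]

theorem contractR_book_inl (i : Unit) :
    contractR U ((coordBasis m).coord (Sum.inl i)) (bookBivector U) = -eulerField U := by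
  rw [bookBivector_eq, map_sum, eulerField, ← Finset.sum_neg_distrib]
  refine Finset.sum_congr rfl fun j _ => ?_
  rw [contractR_tmul, contractRight_ι_mul_ι, coordBasis_coord_inl, coordBasis_coord_inl,
    linearField_eq]
  simp [TensorProduct.tmul_neg]

theorem contractR_book_inr (j : Fin m) :
    contractR U ((coordBasis m).coord (Sum.inr j)) (bookBivector U)
      = partialT U * (uCoord U j ⊗ₜ 1) := by
  rw [bookBivector_eq, map_sum, Finset.sum_eq_single j]
  · rw [contractR_tmul, contractRight_ι_mul_ι, coordBasis_coord_inr, coordBasis_coord_inr]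
    simp [partialT]
  · intro i _ hij
    rw [contractR_tmul, contractRight_ι_mul_ι, coordBasis_coord_inr, coordBasis_coord_inr]
    simp [hij.symm]
  · simp

theorem bookDiff_apply (x : Multivector U) :
    bookDiff U x = partialT U * lieEuler U x - eulerField U * coeffDeriv U (1, 0) x := by
  change schouten (coordBasis m) (bookBivector U) x = _
  simp only [schouten, Fintype.sum_sum_type, Finset.univ_unique, Finset.sum_singleton,
    coordBasis_inl, coordBasis_inr, coeffDeriv_book_inl, coeffDeriv_book_inr, contractR_book_inl,
    contractR_book_inr, lieEuler, LinearMap.sum_apply, LinearMap.sub_apply, LinearMap.comp_apply,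
    LinearMap.mulLeft_apply, Finset.mul_sum, mul_sub, mul_assoc, zero_mul, sub_zero, neg_mul]
  abel

theorem bookDiff_partialT : bookDiff U (partialT U) = 0 := by
  have h1 : ∀ v, coeffDeriv U v (partialT U) = 0 := fun v => by
    rw [partialT, coeffDeriv_tmul, Derivation.map_one_eq_zero, TensorProduct.zero_tmul]
  have h2 : lieEuler U (partialT U) = 0 := by
    rw [lieEuler, LinearMap.sum_apply]
    refine Finset.sum_eq_zero fun i _ => ?_
    rw [LinearMap.sub_apply, LinearMap.comp_apply, LinearMap.comp_apply, h1, partialT,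
      contractL_tmul, CliffordAlgebra.contractLeft_ι, coordBasis_coord_inr]
    simp
  rw [bookDiff_apply, h1, h2, mul_zero, mul_zero, sub_zero]

theorem bookDiff_linearField (i j : Fin m) : bookDiff U (linearField U i j) = 0 := by
  have h1 : coeffDeriv U (1, 0) (linearField U i j) = 0 := by
    rw [linearField_eq, coeffDeriv_tmul, dirDeriv_uCoord]
    simp
  have h2 : lieEuler U (linearField U i j) = 0 := by
    simp only [lieEuler, LinearMap.sum_apply, LinearMap.sub_apply, LinearMap.comp_apply,
      LinearMap.mulLeft_apply, linearField_eq, coeffDeriv_tmul, contractL_tmul, dirDeriv_uCoord,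
      CliffordAlgebra.contractLeft_ι, coordBasis_coord_inr, Finset.sum_sub_distrib, partialU]
    rw [Finset.sum_eq_single i, Finset.sum_eq_single j]
    · simp
    · intro k _ hk
      simp [hk]
    · simp
    · intro k _ hk
      simp [hk.symm]
    · simp
  rw [bookDiff_apply, h1, h2, mul_zero, mul_zero, sub_zero]

theorem coeffDeriv_lieEuler (x : Multivector U) :
    coeffDeriv U (1, 0) (lieEuler U x) = lieEuler U (coeffDeriv U (1, 0) x) := by
  simp only [lieEuler, LinearMap.sum_apply, map_sum]
  refine Finset.sum_congr rfl fun i _ => ?_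
  induction x using TensorProduct.induction_on with
  | zero => simp
  | add x y hx hy => simp only [map_add, hx, hy]
  | tmul f a =>
    simp only [LinearMap.sub_apply, LinearMap.comp_apply, LinearMap.mulLeft_apply, map_sub,
      coeffDeriv_mul, coeffDeriv_tmul, contractL_tmul, dirDeriv_uCoord, partialU,
      Derivation.map_one_eq_zero, dirDeriv_comm (1, 0) (0, Pi.single i 1) f]
    simp

/-- The Poisson differential of the book structure squares to zero. -/
theorem bookDiff_bookDiff (x : Multivector U) : bookDiff U (bookDiff U x) = 0 := by
  have hE : bookDiff U (eulerField U) = 0 := by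
    rw [eulerField, map_sum]
    exact Finset.sum_eq_zero fun i _ => bookDiff_linearField U i i
  have hT : ∀ y, partialT U * y = parity U y * partialT U := vector_mul 1 _
  have hEm : ∀ y, eulerField U * y = parity U y * eulerField U := fun y => by
    simp only [eulerField, Finset.sum_mul, Finset.mul_sum, linearField_eq, vector_mul]
  have pT : parity U (partialT U) = -partialT U := by
    rw [partialT, parity_tmul, CliffordAlgebra.involute_ι, TensorProduct.tmul_neg]
  have pE : parity U (eulerField U) = -eulerField U := by
    simp only [eulerField, map_sum, linearField_eq, parity_tmul, CliffordAlgebra.involute_ι,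
      TensorProduct.tmul_neg, Finset.sum_neg_distrib]
  have two : ∀ y : Multivector U, y = -y → y = 0 := fun y hy => by
    have h2 : (2 : ℝ) • y = 0 := by
      rw [two_smul]
      nth_rewrite 1 [hy]
      exact neg_add_cancel y
    exact (smul_eq_zero.mp h2).resolve_left two_ne_zero
  have TT : partialT U * partialT U = 0 := two _ (by
    nth_rewrite 1 [hT]
    rw [pT, neg_mul])
  have EE : eulerField U * eulerField U = 0 := two _ (by
    nth_rewrite 1 [hEm]
    rw [pE, neg_mul])
  have ET : eulerField U * partialT U = -(partialT U * eulerField U) := by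
    rw [hEm, pT, neg_mul]
  have hd := poissonDiff_mul (coordBasis m) (bookBivector_mem U)
  rw [bookDiff_apply U x, map_sub, hd, hd, bookDiff_partialT, hE, pT, pE, bookDiff_apply,
    bookDiff_apply, coeffDeriv_lieEuler]
  simp only [zero_mul, zero_add, neg_mul, mul_sub, ← mul_assoc, TT, EE, ET]
  abel

/-- The Poisson cohomology ring of the book Poisson structure on `U`. -/
abbrev BookCohomology : Type := PoissonCohomology (coordBasis m) (bookBivector_mem U)

/-- The degree `k` part of the cohomology: classes of closed `k`-vector fields. -/
def bookCohomologyOfDegree (k : ℕ) : Submodule ℝ (BookCohomology U) :=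
  ((multivectorsOfDegree U k).comap
    (closedMultivectors (coordBasis m) (bookBivector_mem U)).val.toLinearMap).map
    (Ideal.Quotient.mkₐ ℝ (exactMultivectors (coordBasis m) (bookBivector_mem U))).toLinearMap

/-- The real span of `∂_t` and all `u_i ∂_{u_j}` inside the vector fields on `U`. -/
def linearFieldSpan : Submodule ℝ (Multivector U) :=
  Submodule.span ℝ ({partialT U} ∪ Set.range fun p : Fin m × Fin m => linearField U p.1 p.2)

/-- The exterior algebra of multivector fields generated by `∂_t` and the `u_i ∂_{u_j}`: the real
subalgebra, for the wedge product of multivector fields on `U`, generated by their span. -/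
def linearFieldAlgebra : Subalgebra ℝ (Multivector U) :=
  Algebra.adjoin ℝ (linearFieldSpan U : Set (Multivector U))

/-- The elements of degree `k` in the subalgebra generated by `∂_t` and the `u_i ∂_{u_j}`. -/
def linearFieldAlgebraOfDegree (k : ℕ) : Submodule ℝ (linearFieldAlgebra U) :=
  (multivectorsOfDegree U k).comap (linearFieldAlgebra U).val.toLinearMap

theorem linearFieldAlgebra_le :
    linearFieldAlgebra U ≤ closedMultivectors (coordBasis m) (bookBivector_mem U) := by
  have h : linearFieldSpan U ≤ LinearMap.ker (bookDiff U) := by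
    refine Submodule.span_le.mpr ?_
    rintro x (rfl | ⟨p, rfl⟩)
    · exact bookDiff_partialT U
    · exact bookDiff_linearField U p.1 p.2
  exact Algebra.adjoin_le fun x hx => h hx

/-- The Euler field as an element of the subalgebra generated by `∂_t` and the `u_i ∂_{u_j}`. -/
def eulerElement : linearFieldAlgebra U :=
  ⟨eulerField U, Subalgebra.sum_mem _ fun i _ =>
    Algebra.subset_adjoin (Submodule.subset_span (Or.inr ⟨(i, i), rfl⟩))⟩

/-- The ring homomorphism that sends an element of the subalgebra generated by `∂_t` and the
`u_i ∂_{u_j}`, all of whose elements are closed, to its cohomology class. -/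
def naturalMap : linearFieldAlgebra U →ₐ[ℝ] BookCohomology U :=
  (Ideal.Quotient.mkₐ ℝ (exactMultivectors (coordBasis m) (bookBivector_mem U))).comp
    (Subalgebra.inclusion (linearFieldAlgebra_le U))

end Book

end BookPoisson

end

/-! Write D for the derivative of coefficients along t, L for the Lie derivative along E, and m = n
- 1. In coordinates the differential is d x = ∂_t ∧ L x - E ∧ D x (`bookDiff_apply`), and everything
follows from two homotopy formulas and the spectrum of L.

Removing t. Contraction ι with dt satisfies d ι + ι d = L (`bookDiff_contractT`), and the divergence
in the variables u satisfies d div + div d = -(L + m) D (`bookDiff_divergence`). In the combination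
of the two the terms with L D cancel and the multiple m D remains. As m ≠ 0 and D is onto (connected
fibers give primitives in t), each closed field is cohomologous to one that is independent of t
(`exists_coeffDeriv_eq_zero`).

Fields independent of t. On f ⊗ w, with w a wedge of coordinate vectors of which k are of the form
∂_{u_i}, L acts as E - k on f. For smooth functions on a star-shaped domain, each f is (E - k) g
plus a homogeneous polynomial of degree k (`exists_eulerDeriv_sub_smul`), and (E - k)² f = 0 forces
(E - k) f = 0 (`eulerDeriv_sub_smul_eq_zero`). Polynomial coefficients of degree k on words with k
factors ∂_{u_i} are exactly what products of ∂_t and u_i ∂_{u_j} can produce, so a closed field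
becomes L z + p with p in the linear subalgebra. The second fact gives ι d z = 0, hence L z = d ι z
is exact, and the natural map is onto (`exists_linearFieldAlgebra_add`).

The kernel. Let T replace the coefficient of a word with k factors ∂_{u_i} by its Taylor part of
degree k at a point over u = 0. Then T is the identity on the subalgebra, commutes with left
multiplication by it, kills the image of L and preserves degrees. Thus T (d y) = -E ∧ T (D y)
(`taylorProj_bookDiff`), so exact elements of the subalgebra are multiples of E. Conversely E =
d(-t). The same formula shows that T x represents the class of a closed x, which gives surjectivity
in each degree. -/

noncomputable section

namespace BookPoisson

/-! ### Smooth dependence of integrals over [0, 1] on parameters. -/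

section Parametric

variable {X G : Type} [NormedAddCommGroup X] [NormedSpace ℝ X]
  [NormedAddCommGroup G] [NormedSpace ℝ G]

theorem hasFDerivAt_integral_unitInterval {g : ℝ × X → G} {O : Set (ℝ × X)} (hO : IsOpen O)
    (hg : ContDiffOn ℝ ∞ g O) {V : Set X} (hV : IsOpen V)
    (hVO : ∀ x ∈ V, ∀ r ∈ Set.Icc (0 : ℝ) 1, (r, x) ∈ O) {x₀ : X} (hx₀ : x₀ ∈ V) :
    HasFDerivAt (fun x => ∫ r in (0 : ℝ)..1, g (r, x))
      (∫ r in (0 : ℝ)..1, (fderiv ℝ g (r, x₀)).comp (ContinuousLinearMap.inr ℝ ℝ X)) x₀ := by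
  have hg' : ContDiffOn ℝ ∞
      (fun z => (fderiv ℝ g z).comp (ContinuousLinearMap.inr ℝ ℝ X)) O :=
    (hg.fderiv_of_isOpen hO (m := ∞) (by simp)).clm_comp contDiffOn_const
  have hslice : ∀ x ∈ V, ContinuousOn (fun r : ℝ => (r, x)) (Set.Icc 0 1) :=
    fun x _ => by fun_prop
  have hcont : ∀ x ∈ V, ContinuousOn (fun r => g (r, x)) (Set.Icc 0 1) := fun x hx =>
    hg.continuousOn.comp (hslice x hx) (hVO x hx)
  have hcont' := hg'.continuousOn.comp (hslice x₀ hx₀) (hVO x₀ hx₀)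
  obtain ⟨C, hC⟩ := isCompact_Icc.exists_bound_of_continuousOn hcont'
  -- Domination: C bounds the derivative on the compact slice over x₀, so by continuity and
  -- compactness of [0, 1] the bound C + 1 holds over a whole neighborhood of x₀.
  have hbound : ∀ᶠ x in nhds x₀, ∀ r ∈ Set.Icc (0 : ℝ) 1,
      ‖(fderiv ℝ g (r, x)).comp (ContinuousLinearMap.inr ℝ ℝ X)‖ ≤ C + 1 := by
    refine isCompact_Icc.eventually_forall_of_forall_eventually fun r hr => ?_
    have hca : ContinuousAt (fun z : X × ℝ =>
        ‖(fderiv ℝ g (z.2, z.1)).comp (ContinuousLinearMap.inr ℝ ℝ X)‖) (x₀, r) := by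
      have h1 := (hg'.continuousOn.continuousAt (hO.mem_nhds (hVO x₀ hx₀ r hr))).norm
      have h2 : ContinuousAt (fun z : X × ℝ => (z.2, z.1)) (x₀, r) := by fun_prop
      exact ContinuousAt.comp (x := (x₀, r)) (f := fun z : X × ℝ => (z.2, z.1)) h1 h2
    refine (hca.eventually_lt continuousAt_const (lt_of_le_of_lt (hC r hr) (lt_add_one C))).mono
      fun z hz => hz.le
  have hmeas : ∀ {Y : Type} [NormedAddCommGroup Y] {φ : ℝ → Y}, ContinuousOn φ (Set.Icc 0 1) →
      MeasureTheory.AEStronglyMeasurable φ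
        (MeasureTheory.volume.restrict (Set.uIoc (0 : ℝ) 1)) := by
    intro Y _ φ hφ
    rw [Set.uIoc_of_le zero_le_one]
    exact (hφ.mono Set.Ioc_subset_Icc_self).aestronglyMeasurable measurableSet_Ioc
  refine intervalIntegral.hasFDerivAt_integral_of_dominated_of_fderiv_le (𝕜 := ℝ)
    (F := fun x r => g (r, x)) (F' := fun x r => (fderiv ℝ g (r, x)).comp
      (ContinuousLinearMap.inr ℝ ℝ X)) (bound := fun _ => C + 1)
    (Filter.inter_mem hbound (hV.mem_nhds hx₀)) ?_ ?_ (hmeas hcont') ?_ ?_ ?_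
  · filter_upwards [hV.mem_nhds hx₀] with x hx using hmeas (hcont x hx)
  · refine ContinuousOn.intervalIntegrable ?_
    rw [Set.uIcc_of_le zero_le_one]
    exact hcont x₀ hx₀
  · refine Filter.Eventually.of_forall fun r hr x hx => ?_
    rw [Set.uIoc_of_le zero_le_one] at hr
    exact hx.1 r (Set.Ioc_subset_Icc_self hr)
  · simp
  · refine Filter.Eventually.of_forall fun r hr x hx => ?_
    rw [Set.uIoc_of_le zero_le_one] at hr
    have hd : HasFDerivAt g (fderiv ℝ g (r, x)) (r, x) :=
      ((hg.contDiffAt (hO.mem_nhds (hVO x hx.2 r (Set.Ioc_subset_Icc_self hr)))).differentiableAt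
        (by simp)).hasFDerivAt
    exact hd.comp x (hasFDerivAt_prodMk_right r x)

/-- The derivative of such an integral is again an integral of the same kind, with integrand valued
in linear maps. The induction on the order of smoothness therefore has to let the target space G
vary. -/
theorem contDiffOn_integral_unitInterval {g : ℝ × X → G} {O : Set (ℝ × X)} (hO : IsOpen O)
    (hg : ContDiffOn ℝ ∞ g O) {V : Set X} (hV : IsOpen V)
    (hVO : ∀ x ∈ V, ∀ r ∈ Set.Icc (0 : ℝ) 1, (r, x) ∈ O) :
    ContDiffOn ℝ ∞ (fun x => ∫ r in (0 : ℝ)..1, g (r, x)) V := by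
  rw [contDiffOn_infty]
  intro n
  induction n generalizing G with
  | zero =>
    refine contDiffOn_zero.mpr fun x hx => ?_
    exact (hasFDerivAt_integral_unitInterval hO hg hV hVO hx).continuousAt.continuousWithinAt
  | succ n ih =>
    push_cast
    rw [contDiffOn_succ_iff_fderiv_of_isOpen hV]
    refine ⟨fun x hx => (hasFDerivAt_integral_unitInterval hO hg hV hVO
      hx).differentiableAt.differentiableWithinAt, by simp, ?_⟩
    have hg' : ContDiffOn ℝ ∞
        (fun z => (fderiv ℝ g z).comp (ContinuousLinearMap.inr ℝ ℝ X)) O :=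
      (hg.fderiv_of_isOpen hO (m := ∞) (by simp)).clm_comp contDiffOn_const
    exact (ih hg').congr fun x hx => (hasFDerivAt_integral_unitInterval hO hg hV hVO hx).fderiv

end Parametric

/-! ### Radial integrals and the Euler operator on star-shaped open sets. -/

section Radial

variable {X : Type} [NormedAddCommGroup X] [NormedSpace ℝ X] {W : Set X}

theorem isOpen_radial (hW : IsOpen W) : IsOpen {z : ℝ × X | z.1 • z.2 ∈ W} :=
  hW.preimage (by fun_prop)

theorem radial_mem (hs : StarConvex ℝ 0 W) : ∀ x ∈ W, ∀ r ∈ Set.Icc (0 : ℝ) 1, r • x ∈ W :=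
  fun _ hx _ hr => starConvex_zero_iff.mp hs hx hr.1 hr.2

theorem contDiffOn_radialIntegral (hW : IsOpen W) (hs : StarConvex ℝ 0 W) {F : X → ℝ}
    (hF : ContDiffOn ℝ ∞ F W) : ContDiffOn ℝ ∞ (fun x => ∫ r in (0 : ℝ)..1, F (r • x)) W :=
  contDiffOn_integral_unitInterval (g := fun z : ℝ × X => F (z.1 • z.2)) (isOpen_radial hW)
    (hF.comp (by fun_prop) fun _ hz => hz) hW (radial_mem hs)

theorem hasDerivAt_radial (hW : IsOpen W) {F : X → ℝ} (hF : ContDiffOn ℝ ∞ F W) {x : X} {r : ℝ}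
    (hr : r • x ∈ W) : HasDerivAt (fun r : ℝ => F (r • x)) (fderiv ℝ F (r • x) x) r := by
  have hd : HasFDerivAt F (fderiv ℝ F (r • x)) (r • x) :=
    ((hF.contDiffAt (hW.mem_nhds hr)).differentiableAt (by simp)).hasFDerivAt
  have h1 : HasDerivAt (fun r : ℝ => r • x) x r := by
    simpa using (hasDerivAt_id r).smul_const x
  exact hd.comp_hasDerivAt r h1

theorem continuousOn_radial (hs : StarConvex ℝ 0 W) {F : X → ℝ} (hF : ContinuousOn F W) {x : X}
    (hx : x ∈ W) : ContinuousOn (fun r : ℝ => F (r • x)) (Set.uIcc 0 1) := by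
  rw [Set.uIcc_of_le zero_le_one]
  exact hF.comp (by fun_prop) (radial_mem hs x hx)

/-- Hadamard's lemma on a star-shaped open set. -/
theorem eq_add_integral_fderiv (hW : IsOpen W) (hs : StarConvex ℝ 0 W) {F : X → ℝ}
    (hF : ContDiffOn ℝ ∞ F W) {x : X} (hx : x ∈ W) :
    F x = F 0 + ∫ r in (0 : ℝ)..1, fderiv ℝ F (r • x) x := by
  have hc : ContinuousOn (fun r : ℝ => fderiv ℝ F (r • x) x) (Set.uIcc 0 1) := by
    have h := (hF.fderiv_of_isOpen hW (m := ∞) (by simp)).clm_apply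
      (contDiffOn_const (c := x))
    exact continuousOn_radial (F := fun y => fderiv ℝ F y x) hs h.continuousOn hx
  rw [intervalIntegral.integral_eq_sub_of_hasDerivAt (f := fun r : ℝ => F (r • x))
    (fun r hr => hasDerivAt_radial hW hF ?_) hc.intervalIntegrable]
  · simp
  · rw [Set.uIcc_of_le zero_le_one] at hr
    exact radial_mem hs x hx r hr

/-- The radial average inverts `1 +` the Euler operator. -/
theorem fderiv_radialIntegral (hW : IsOpen W) (hs : StarConvex ℝ 0 W) {F : X → ℝ}
    (hF : ContDiffOn ℝ ∞ F W) {x : X} (hx : x ∈ W) :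
    fderiv ℝ (fun x => ∫ r in (0 : ℝ)..1, F (r • x)) x x + ∫ r in (0 : ℝ)..1, F (r • x) = F x := by
  set K : X → ℝ := fun x => ∫ r in (0 : ℝ)..1, F (r • x) with hK
  -- By substitution l K(l x) is the integral of F(r x) over [0, l]. Both expressions are
  -- differentiated at l = 1: the product rule gives K + E K, the fundamental theorem of calculus
  -- gives F.
  have h1 : HasDerivAt (fun l : ℝ => l * K (l • x)) (K x + fderiv ℝ K x x) 1 := by
    have h := (hasDerivAt_id (1 : ℝ)).mul
      (hasDerivAt_radial hW (contDiffOn_radialIntegral hW hs hF) (x := x) (r := 1) (by simpa))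
    simpa [hK] using! h
  have h2 : HasDerivAt (fun l : ℝ => ∫ r in (0 : ℝ)..l, F (r • x)) (F ((1 : ℝ) • x)) 1 := by
    have hop : IsOpen {r : ℝ | r • x ∈ W} := hW.preimage (by fun_prop)
    have hco : ContinuousOn (fun r : ℝ => F (r • x)) {r : ℝ | r • x ∈ W} :=
      hF.continuousOn.comp (by fun_prop) fun _ h => h
    have h1m : (1 : ℝ) ∈ {r : ℝ | r • x ∈ W} := by simpa
    exact intervalIntegral.integral_hasDerivAt_right
      (continuousOn_radial hs hF.continuousOn hx).intervalIntegrable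
      (hco.stronglyMeasurableAtFilter hop 1 h1m) (hco.continuousAt (hop.mem_nhds h1m))
  have h3 : (fun l : ℝ => l * K (l • x)) = fun l : ℝ => ∫ r in (0 : ℝ)..l, F (r • x) := by
    funext l
    have h := intervalIntegral.smul_integral_comp_add_mul (a := 0) (b := 1)
      (fun r : ℝ => F (r • x)) l 0
    simpa [hK, smul_smul, mul_comm] using h
  rw [h3] at h1
  have h := h1.unique h2
  rw [one_smul] at h
  rw [← h, add_comm]

/-- The hypothesis says that r F(r x) has derivative zero on [0, 1]. It vanishes at r = 0, hence
also at r = 1. -/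
theorem eq_zero_of_fderiv_add_self (hW : IsOpen W) (hs : StarConvex ℝ 0 W) {F : X → ℝ}
    (hF : ContDiffOn ℝ ∞ F W) (h0 : ∀ x ∈ W, fderiv ℝ F x x + F x = 0) {x : X} (hx : x ∈ W) :
    F x = 0 := by
  have hd : ∀ r ∈ Set.uIcc (0 : ℝ) 1, HasDerivAt (fun r : ℝ => r * F (r • x)) 0 r := by
    intro r hr
    rw [Set.uIcc_of_le zero_le_one] at hr
    have hm := radial_mem hs x hx r hr
    have h := (hasDerivAt_id r).mul (hasDerivAt_radial hW hF hm)
    have e := h0 _ hm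
    rw [map_smul, smul_eq_mul] at e
    have e' : 1 * F (r • x) + r * fderiv ℝ F (r • x) x = 0 := by linarith
    simpa only [id_eq, e'] using! h
  have h := intervalIntegral.integral_eq_sub_of_hasDerivAt hd (by simp)
  simpa using h.symm

end Radial

/-! ### Functions on U: independence of t, primitives in t, Hadamard's lemma. -/

section Functions

theorem Smooth.ext {F : Type*} [NormedAddCommGroup F] [NormedSpace ℝ F] {U : Opens F}
    {f g : Smooth U} (h : ∀ x, f.1 x = g.1 x) : f = g :=
  Subtype.ext (funext h)

/-- The restriction to `U` of a function that is smooth on `U`. -/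
def Smooth.ofContDiffOn {F : Type*} [NormedAddCommGroup F] [NormedSpace ℝ F] {U : Opens F}
    (f : F → ℝ) (hf : ContDiffOn ℝ ∞ f U) : Smooth U :=
  ⟨fun x => f x, fun x => by
    rw [contMDiffAt_subtype_iff (f := f), contMDiffAt_iff_contDiffAt]
    exact hf.contDiffAt (U.isOpen.mem_nhds x.2)⟩

theorem Smooth.dirDeriv_ofContDiffOn {F : Type*} [NormedAddCommGroup F] [NormedSpace ℝ F]
    {U : Opens F} (f : F → ℝ) (hf : ContDiffOn ℝ ∞ f U) (v : F) (x : U) :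
    (dirDeriv U v (Smooth.ofContDiffOn f hf)).1 x = fderiv ℝ f x v := by
  exact congrArg (fun φ : F →L[ℝ] ℝ => φ v)
    (zeroExt_eventuallyEq (f := (Smooth.ofContDiffOn f hf).1) (g := f) (fun _ => rfl) x).fderiv_eq

theorem Smooth.contDiffOn_zeroExt {F : Type*} [NormedAddCommGroup F] [NormedSpace ℝ F]
    {U : Opens F} (f : Smooth U) : ContDiffOn ℝ ∞ (zeroExt f.1) U :=
  fun x hx => (zeroExt_contDiffAt f ⟨x, hx⟩).contDiffWithinAt

variable {m : ℕ} (U : Opens (ℝ × (Fin m → ℝ)))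

/-- The projection of `U` to the space of the coordinates `u`. -/
def shadow : Opens (Fin m → ℝ) :=
  ⟨Prod.snd '' (U : Set (ℝ × (Fin m → ℝ))), isOpenMap_snd _ U.isOpen⟩

/-- The partial derivative `∂/∂u_i` of functions. -/
abbrev derivU (i : Fin m) : Derivation ℝ (Smooth U) (Smooth U) := dirDeriv U (0, Pi.single i 1)

/-- The partial derivative `∂/∂t` of functions. -/
abbrev derivT : Derivation ℝ (Smooth U) (Smooth U) := dirDeriv U (1, 0)

/-- The Euler field as a derivation of functions. -/
def eulerDeriv : Derivation ℝ (Smooth U) (Smooth U) := ∑ i, uCoord U i • derivU U i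

theorem eulerDeriv_apply (f : Smooth U) :
    eulerDeriv U f = ∑ i, uCoord U i * derivU U i f := by
  rw [eulerDeriv, ← Derivation.coeFnAddMonoidHom_apply, map_sum, Finset.sum_apply]
  rfl

variable {U}

theorem snd_mem_shadow (x : U) : (x : ℝ × (Fin m → ℝ)).2 ∈ shadow U := ⟨x, x.2, rfl⟩

/-- A smooth function of `u`, as a function on `U` that does not depend on `t`. -/
def pullSnd (F : (Fin m → ℝ) → ℝ) (hF : ContDiffOn ℝ ∞ F (shadow U)) : Smooth U :=
  Smooth.ofContDiffOn (fun x => F x.2)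
    (hF.comp contDiff_snd.contDiffOn fun x hx => snd_mem_shadow ⟨x, hx⟩)

theorem dirDeriv_pullSnd (F : (Fin m → ℝ) → ℝ) (hF : ContDiffOn ℝ ∞ F (shadow U))
    (v : ℝ × (Fin m → ℝ)) (x : U) :
    (dirDeriv U v (pullSnd F hF)).1 x = fderiv ℝ F (x : ℝ × (Fin m → ℝ)).2 v.2 := by
  rw [pullSnd, Smooth.dirDeriv_ofContDiffOn]
  have hd : HasFDerivAt F (fderiv ℝ F (x : ℝ × (Fin m → ℝ)).2) (x : ℝ × (Fin m → ℝ)).2 :=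
    ((hF.contDiffAt ((shadow U).isOpen.mem_nhds (snd_mem_shadow x))).differentiableAt
      (by simp)).hasFDerivAt
  exact congrArg (fun φ : ℝ × (Fin m → ℝ) →L[ℝ] ℝ => φ v)
    (hd.comp (x : ℝ × (Fin m → ℝ)) hasFDerivAt_snd).fderiv

theorem derivT_pullSnd (F : (Fin m → ℝ) → ℝ) (hF : ContDiffOn ℝ ∞ F (shadow U)) :
    derivT U (pullSnd F hF) = 0 :=
  Smooth.ext fun x => by rw [dirDeriv_pullSnd]; exact map_zero _

theorem Smooth.sum_apply {ι : Type*} (s : Finset ι) (f : ι → Smooth U) (x : U) :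
    (∑ i ∈ s, f i).1 x = ∑ i ∈ s, (f i).1 x := by
  induction s using Finset.cons_induction with
  | empty => rfl
  | cons a s ha ih => rw [Finset.sum_cons, Finset.sum_cons, ← ih]; rfl

theorem sum_mul_clm (φ : (Fin m → ℝ) →L[ℝ] ℝ) (u : Fin m → ℝ) :
    ∑ i, u i * φ (Pi.single i 1) = φ u := by
  conv_rhs => rw [pi_eq_sum_univ' u, map_sum]
  refine Finset.sum_congr rfl fun i _ => ?_
  rw [map_smul, smul_eq_mul]

theorem eulerDeriv_pullSnd (F : (Fin m → ℝ) → ℝ) (hF : ContDiffOn ℝ ∞ F (shadow U)) (x : U) :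
    (eulerDeriv U (pullSnd F hF)).1 x
      = fderiv ℝ F (x : ℝ × (Fin m → ℝ)).2 (x : ℝ × (Fin m → ℝ)).2 := by
  rw [eulerDeriv_apply, Smooth.sum_apply, ← sum_mul_clm]
  refine Finset.sum_congr rfl fun i _ => ?_
  change _ * (derivU U i (pullSnd F hF)).1 x = _
  rw [dirDeriv_pullSnd]
  rfl

section Fibers

variable (hfib : ∀ u : Fin m → ℝ, IsPreconnected {x : ℝ × (Fin m → ℝ) | x ∈ U ∧ x.2 = u})

include hfib

theorem isPreconnected_fiber (u : Fin m → ℝ) : IsPreconnected {t : ℝ | (t, u) ∈ U} := by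
  have h := (hfib u).image Prod.fst continuous_fst.continuousOn
  convert h using 1
  ext t
  constructor
  · intro ht
    exact ⟨(t, u), ⟨ht, rfl⟩, rfl⟩
  · rintro ⟨⟨t', u'⟩, ⟨h1, h2⟩, h3⟩
    simp only at h2 h3
    subst h2 h3
    exact h1

theorem eq_of_derivT_eq_zero {f : Smooth U} (hf : derivT U f = 0) (t t' : ℝ) (u : Fin m → ℝ)
    (ht : (t, u) ∈ U) (ht' : (t', u) ∈ U) : zeroExt f.1 (t, u) = zeroExt f.1 (t', u) := by
  have hd : ∀ r : ℝ, (r, u) ∈ U → HasDerivAt (fun r : ℝ => zeroExt f.1 (r, u)) 0 r := by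
    intro r hr
    have h1 := ((zeroExt_contDiffAt f ⟨_, hr⟩).differentiableAt (by simp)).hasFDerivAt
    have h2 := h1.comp_hasDerivAt r ((hasDerivAt_id r).prodMk (hasDerivAt_const r u))
    have h3 : fderiv ℝ (zeroExt f.1) (r, u) (1, 0) = 0 := by
      rw [← dirDeriv_apply (1, 0) f ⟨_, hr⟩]
      exact congrArg (fun g : Smooth U => g.1 ⟨_, hr⟩) hf
    rw [← h3]
    exact h2
  have hop : IsOpen {t : ℝ | (t, u) ∈ U} := U.isOpen.preimage (by fun_prop)
  exact hop.is_const_of_deriv_eq_zero (isPreconnected_fiber hfib u)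
    (fun r hr => (hd r hr).differentiableAt.differentiableWithinAt)
    (fun r hr => (hd r hr).deriv) ht ht'

/-- A function that does not depend on `t` is a function of `u`. -/
theorem exists_eq_pullSnd {f : Smooth U} (hf : derivT U f = 0) :
    ∃ F hF, f = pullSnd F hF := by
  classical
  -- An arbitrary choice of a point in each fiber, with no continuity. It suffices because f is
  -- constant on fibers, so near any point (t, u) the chosen point may be replaced by the one with
  -- this fixed t.
  choose! s hs hs' using fun (u : Fin m → ℝ) (hu : u ∈ shadow U) => hu
  have key : ∀ t u, (t, u) ∈ U → zeroExt f.1 (s u) = zeroExt f.1 (t, u) := by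
    intro t u h
    have hu : u ∈ shadow U := ⟨_, h, rfl⟩
    have h1 : s u = ((s u).1, u) := Prod.ext rfl (hs' u hu)
    rw [h1]
    exact eq_of_derivT_eq_zero hfib hf _ _ u (h1 ▸ hs u hu) h
  refine ⟨fun u => zeroExt f.1 (s u), ?_, ?_⟩
  · rintro _ ⟨⟨t, u⟩, h, rfl⟩
    refine ContDiffAt.contDiffWithinAt ?_
    have hloc : (fun u => zeroExt f.1 (s u)) =ᶠ[nhds u] fun u => zeroExt f.1 (t, u) := by
      have hop : IsOpen {u : Fin m → ℝ | (t, u) ∈ U} := U.isOpen.preimage (by fun_prop)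
      filter_upwards [hop.mem_nhds h] with y hy using key t y hy
    refine ContDiffAt.congr_of_eventuallyEq ?_ hloc
    exact (zeroExt_contDiffAt f ⟨_, h⟩).comp u (contDiffAt_const.prodMk contDiffAt_id)
  · refine Smooth.ext fun x => ?_
    change _ = zeroExt f.1 (s (x : ℝ × (Fin m → ℝ)).2)
    rw [key (x : ℝ × (Fin m → ℝ)).1 (x : ℝ × (Fin m → ℝ)).2 x.2]
    exact (zeroExt_apply f.1 x).symm

/-- The fibers are intervals, hence convex, and a constant t stays admissible near each u because U
is open. A partition of unity glues these local constant sections. -/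
theorem exists_smooth_section :
    ∃ s : (Fin m → ℝ) → ℝ, ContDiffOn ℝ ∞ s (shadow U) ∧ ∀ u ∈ shadow U, (s u, u) ∈ U := by
  have : LocallyCompactSpace (shadow U) := (shadow U).isOpen.locallyCompactSpace
  obtain ⟨g, hg⟩ := exists_contMDiffMap_forall_mem_convex_of_local_const
    (n := ⊤) (M := shadow U) 𝓘(ℝ, Fin m → ℝ) (t := fun u => {t : ℝ | (t, (u : Fin m → ℝ)) ∈ U})
    (fun u => (isPreconnected_fiber hfib u).ordConnected.convex) (by
      rintro ⟨_, ⟨⟨t, u⟩, h, rfl⟩⟩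
      refine ⟨t, ?_⟩
      have hop : IsOpen {v : shadow U | (t, (v : Fin m → ℝ)) ∈ U} := U.isOpen.preimage (by fun_prop)
      exact hop.mem_nhds h)
  let G : Smooth (shadow U) := ⟨fun u => g u, g.contMDiff⟩
  refine ⟨zeroExt G.1, G.contDiffOn_zeroExt, fun u hu => ?_⟩
  rw [zeroExt_apply G.1 ⟨u, hu⟩]
  exact hg ⟨u, hu⟩

/-- Integration along `t`, starting from a smooth section. -/
theorem derivT_surjective : Function.Surjective (derivT U) := by
  intro f
  obtain ⟨s, hs, hsU⟩ := exists_smooth_section hfib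
  -- For fixed (t, u), r ↦ g (r, (t, u)) runs along the segment from (s u, u) to (t, u), which lies
  -- in U by convexity of the fiber. Rescaling to [0, 1] fixes the limits of integration, so the
  -- parametric lemma gives smoothness of the primitive I.
  set g : ℝ × (ℝ × (Fin m → ℝ)) → ℝ × (Fin m → ℝ) :=
    fun z => (s z.2.2 + z.1 * (z.2.1 - s z.2.2), z.2.2) with hg
  have hO₁ : IsOpen {z : ℝ × (ℝ × (Fin m → ℝ)) | z.2.2 ∈ shadow U} :=
    (shadow U).isOpen.preimage (by fun_prop)
  have hs₂ : ContDiffOn ℝ ∞ (fun z : ℝ × (ℝ × (Fin m → ℝ)) => s z.2.2)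
      {z | z.2.2 ∈ shadow U} := hs.comp (by fun_prop) fun z hz => hz
  have hgc : ContDiffOn ℝ ∞ g {z | z.2.2 ∈ shadow U} :=
    (hs₂.add (contDiffOn_fst.mul ((contDiff_fst.comp contDiff_snd).contDiffOn.sub hs₂))).prodMk
      (contDiff_snd.comp contDiff_snd).contDiffOn
  have hO : IsOpen ({z : ℝ × (ℝ × (Fin m → ℝ)) | z.2.2 ∈ shadow U} ∩ g ⁻¹' U) :=
    hgc.continuousOn.isOpen_inter_preimage hO₁ U.isOpen
  have hseg : ∀ x ∈ U, ∀ r ∈ Set.Icc (0 : ℝ) 1, g (r, x) ∈ U := by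
    intro x hx r hr
    have hc : Convex ℝ {t : ℝ | (t, x.2) ∈ U} :=
      (isPreconnected_fiber hfib x.2).ordConnected.convex
    exact hc.add_smul_sub_mem (hsU x.2 (snd_mem_shadow ⟨x, hx⟩)) hx hr
  have hG := contDiffOn_integral_unitInterval (g := fun z => zeroExt f.1 (g z)) hO
    (f.contDiffOn_zeroExt.comp (hgc.mono Set.inter_subset_left) fun z hz => hz.2) U.isOpen
    fun x hx r hr => ⟨snd_mem_shadow ⟨x, hx⟩, hseg x hx r hr⟩
  have hsU' : ContDiffOn ℝ ∞ (fun x : ℝ × (Fin m → ℝ) => s x.2) U :=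
    hs.comp contDiff_snd.contDiffOn fun x hx => snd_mem_shadow ⟨x, hx⟩
  set I : ℝ × (Fin m → ℝ) → ℝ := fun x => (x.1 - s x.2) * ∫ r in (0 : ℝ)..1, zeroExt f.1 (g (r, x))
    with hI
  have hIs : ContDiffOn ℝ ∞ I U := (contDiffOn_fst.sub hsU').mul hG
  refine ⟨Smooth.ofContDiffOn I hIs, Smooth.ext fun x => ?_⟩
  obtain ⟨⟨t, u⟩, hx⟩ := x
  rw [Smooth.dirDeriv_ofContDiffOn]
  have hI' : ∀ r, I (r, u) = ∫ y in (s u)..r, zeroExt f.1 (y, u) := by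
    intro r
    have h := intervalIntegral.smul_integral_comp_add_mul (a := 0) (b := 1)
      (fun y : ℝ => zeroExt f.1 (y, u)) (r - s u) (s u)
    simp only [mul_zero, add_zero, mul_one, add_sub_cancel, smul_eq_mul] at h
    rw [← h, hI, hg]
    simp only [mul_comm]
  have h1 : HasDerivAt (fun r => I (r, u)) (fderiv ℝ I (t, u) (1, 0)) t := by
    have h := ((hIs.contDiffAt (U.isOpen.mem_nhds hx)).differentiableAt (by simp)).hasFDerivAt
    exact h.comp_hasDerivAt t ((hasDerivAt_id t).prodMk (hasDerivAt_const t u))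
  have h2 : HasDerivAt (fun r => I (r, u)) (zeroExt f.1 (t, u)) t := by
    have hop : IsOpen {r : ℝ | (r, u) ∈ U} := U.isOpen.preimage (by fun_prop)
    have hco : ContinuousOn (fun r : ℝ => zeroExt f.1 (r, u)) {r : ℝ | (r, u) ∈ U} :=
      f.contDiffOn_zeroExt.continuousOn.comp (by fun_prop) fun _ h => h
    have hsub : Set.uIcc (s u) t ⊆ {r : ℝ | (r, u) ∈ U} :=
      (isPreconnected_fiber hfib u).ordConnected.uIcc_subset (hsU u ⟨_, hx, rfl⟩) hx
    simp only [hI']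
    exact intervalIntegral.integral_hasDerivAt_right (hco.mono hsub).intervalIntegrable
      (hco.stronglyMeasurableAtFilter hop t hx) (hco.continuousAt (hop.mem_nhds hx))
  exact (h1.unique h2).trans (zeroExt_apply f.1 ⟨_, hx⟩)

section Star

variable (hstar : StarConvex ℝ (0 : Fin m → ℝ) (Prod.snd '' (U : Set (ℝ × (Fin m → ℝ)))))

include hstar

/-- Hadamard's lemma for functions that do not depend on `t`. -/
theorem exists_eq_const_add_sum {f : Smooth U} (hf : derivT U f = 0) :
    ∃ (c : ℝ) (g : Fin m → Smooth U), (∀ i, derivT U (g i) = 0) ∧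
      f = algebraMap ℝ (Smooth U) c + ∑ i, uCoord U i * g i := by
  obtain ⟨F, hF, rfl⟩ := exists_eq_pullSnd hfib hf
  have hW := (shadow U).isOpen
  have hFi : ∀ i : Fin m, ContDiffOn ℝ ∞ (fun u => fderiv ℝ F u (Pi.single i 1)) (shadow U) :=
    fun i => (hF.fderiv_of_isOpen hW (m := ∞) (by simp)).clm_apply contDiffOn_const
  -- The coefficient of u_i is the radial average of ∂F/∂u_i.
  refine ⟨F 0, fun i => pullSnd _ (contDiffOn_radialIntegral hW hstar (hFi i)),
    fun i => derivT_pullSnd _ _, Smooth.ext fun x => ?_⟩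
  have hx := snd_mem_shadow x
  refine (eq_add_integral_fderiv hW hstar hF hx).trans ?_
  change _ = F 0 + (∑ i, _ : Smooth U).1 x
  rw [Smooth.sum_apply]
  congr 1
  simp_rw [← sum_mul_clm (fderiv ℝ F _) (x : ℝ × (Fin m → ℝ)).2]
  rw [intervalIntegral.integral_finsetSum]
  · refine Finset.sum_congr rfl fun i _ => ?_
    rw [intervalIntegral.integral_const_mul]
    rfl
  · intro i _
    exact ((continuousOn_radial hstar (hFi i).continuousOn hx).intervalIntegrable).const_mul _

theorem exists_eulerDeriv_add_self {f : Smooth U} (hf : derivT U f = 0) :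
    ∃ g, derivT U g = 0 ∧ eulerDeriv U g + g = f := by
  obtain ⟨F, hF, rfl⟩ := exists_eq_pullSnd hfib hf
  have hW := (shadow U).isOpen
  refine ⟨pullSnd _ (contDiffOn_radialIntegral hW hstar hF), derivT_pullSnd _ _,
    Smooth.ext fun x => ?_⟩
  change (eulerDeriv U _).1 x + _ = _
  rw [eulerDeriv_pullSnd]
  exact fderiv_radialIntegral hW hstar hF (snd_mem_shadow x)

theorem eq_zero_of_eulerDeriv_add_self {f : Smooth U} (hf : derivT U f = 0)
    (h : eulerDeriv U f + f = 0) : f = 0 := by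
  obtain ⟨F, hF, rfl⟩ := exists_eq_pullSnd hfib hf
  refine Smooth.ext fun x => ?_
  refine eq_zero_of_fderiv_add_self (shadow U).isOpen hstar hF ?_ (snd_mem_shadow x)
  rintro _ ⟨y, hy, rfl⟩
  rw [← eulerDeriv_pullSnd F hF ⟨y, hy⟩]
  exact congrArg (fun g : Smooth U => g.1 ⟨y, hy⟩) h

end Star

end Fibers

end Functions

/-! ### The Euler operator, homogeneous polynomials and Taylor parts. -/

section Polynomials

variable {m : ℕ} (U : Opens (ℝ × (Fin m → ℝ)))

/-- Homogeneous polynomials of degree `k` in the coordinates `u_i`, as functions on `U`. -/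
def homogeneousPoly (k : ℕ) : Submodule ℝ (Smooth U) :=
  Submodule.span ℝ (Set.range (uCoord U)) ^ k

variable {U}

theorem uCoord_mul_mem {k : ℕ} {f : Smooth U} (hf : f ∈ homogeneousPoly U k) (i : Fin m) :
    uCoord U i * f ∈ homogeneousPoly U (k + 1) := by
  rw [homogeneousPoly, pow_succ']
  exact Submodule.mul_mem_mul (Submodule.subset_span ⟨i, rfl⟩) hf

theorem algebraMap_mem_homogeneousPoly (c : ℝ) :
    algebraMap ℝ (Smooth U) c ∈ homogeneousPoly U 0 := by
  rw [homogeneousPoly, pow_zero]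
  exact Submodule.mem_one.mpr ⟨c, rfl⟩

theorem derivU_uCoord_mul (i j : Fin m) (f : Smooth U) :
    derivU U i (uCoord U j * f) = (if i = j then f else 0) + uCoord U j * derivU U i f := by
  rw [Derivation.leibniz, dirDeriv_uCoord, smul_eq_mul, smul_eq_mul, add_comm]
  congr 1
  by_cases h : i = j
  · simp [h]
  · simp [h, Ne.symm h]

theorem derivT_uCoord_mul (j : Fin m) (f : Smooth U) :
    derivT U (uCoord U j * f) = uCoord U j * derivT U f := by
  rw [Derivation.leibniz, dirDeriv_uCoord]
  simp

/-- Multiplication by u_j raises the degree by one. Equivalently, (E - (k + 1)) (u_j f) = u_j (E -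
k) f, which drives the induction for the decomposition below. -/
theorem eulerDeriv_uCoord_mul (j : Fin m) (f : Smooth U) :
    eulerDeriv U (uCoord U j * f) = uCoord U j * (eulerDeriv U f + f) := by
  simp only [eulerDeriv_apply, derivU_uCoord_mul, mul_add, Finset.sum_add_distrib, mul_ite,
    mul_zero, Finset.sum_ite_eq', Finset.mem_univ, if_true, Finset.mul_sum]
  rw [add_comm]
  congr 1
  exact Finset.sum_congr rfl fun i _ => by ring

/-- The commutator [∂_i, E] = ∂_i: differentiation lowers the degree by one, so that ∂_i (E - c) =
(E - (c - 1)) ∂_i. -/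
theorem derivU_eulerDeriv (i : Fin m) (f : Smooth U) :
    derivU U i (eulerDeriv U f) = eulerDeriv U (derivU U i f) + derivU U i f := by
  simp only [eulerDeriv_apply, map_sum, derivU_uCoord_mul, Finset.sum_add_distrib,
    Finset.sum_ite_eq, Finset.mem_univ, if_true]
  rw [add_comm]
  congr 1
  exact Finset.sum_congr rfl fun j _ => by rw [dirDeriv_comm]

theorem derivT_eulerDeriv (f : Smooth U) :
    derivT U (eulerDeriv U f) = eulerDeriv U (derivT U f) := by
  simp only [eulerDeriv_apply, map_sum, derivT_uCoord_mul]
  exact Finset.sum_congr rfl fun j _ => by rw [dirDeriv_comm]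

theorem derivT_derivU_eq_zero {f : Smooth U} (hf : derivT U f = 0) (i : Fin m) :
    derivT U (derivU U i f) = 0 := by
  rw [dirDeriv_comm, hf, map_zero]

/-! ### Image and generalized kernel of E - k on functions of u. -/

section Decomposition

variable (hfib : ∀ u : Fin m → ℝ, IsPreconnected {x : ℝ × (Fin m → ℝ) | x ∈ U ∧ x.2 = u})
  (hstar : StarConvex ℝ (0 : Fin m → ℝ) (Prod.snd '' (U : Set (ℝ × (Fin m → ℝ)))))

include hfib hstar

/-- On functions of `u`, the image of `E - k` is a complement of the polynomials of degree `k`. -/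
theorem exists_eulerDeriv_sub_smul (k : ℕ) {f : Smooth U} (hf : derivT U f = 0) :
    ∃ g p, derivT U g = 0 ∧ p ∈ homogeneousPoly U k ∧ f = eulerDeriv U g - (k : ℝ) • g + p := by
  induction k generalizing f with
  | zero =>
    obtain ⟨c, g, hg, rfl⟩ := exists_eq_const_add_sum hfib hstar hf
    choose h hh he using fun i => exists_eulerDeriv_add_self hfib hstar (hg i)
    -- Since E (u_i h_i) = u_i (E h_i + h_i) = u_i g_i, only the constant c of Hadamard's lemma is
    -- left over.
    refine ⟨∑ i, uCoord U i * h i, _, ?_, algebraMap_mem_homogeneousPoly c, ?_⟩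
    · simp only [map_sum, derivT_uCoord_mul, hh, mul_zero, Finset.sum_const_zero]
    · simp only [map_sum, eulerDeriv_uCoord_mul, he]
      rw [Nat.cast_zero, zero_smul, sub_zero, add_comm]
  | succ k ih =>
    obtain ⟨c, g, hg, rfl⟩ := exists_eq_const_add_sum hfib hstar hf
    choose h p hh hp he using fun i => ih (hg i)
    -- On constants E - (k + 1) is multiplication by -(k + 1), so -c / (k + 1) is sent to c.
    refine ⟨algebraMap ℝ _ (-c / (k + 1)) + ∑ i, uCoord U i * h i, ∑ i, uCoord U i * p i, ?_,
      Submodule.sum_mem _ fun i _ => uCoord_mul_mem (hp i) i, ?_⟩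
    · simp only [map_add, Derivation.map_algebraMap, map_sum, derivT_uCoord_mul, hh, mul_zero,
        Finset.sum_const_zero, add_zero]
    · have hk : (k : ℝ) + 1 ≠ 0 := by positivity
      have hc : ((k + 1 : ℕ) : ℝ) • algebraMap ℝ (Smooth U) (-c / (k + 1))
          = - algebraMap ℝ (Smooth U) c := by
        rw [Algebra.smul_def, ← map_mul, ← map_neg]
        congr 1
        push_cast
        field_simp
      have hs : ∑ i, uCoord U i * g i = ∑ i, uCoord U i * (eulerDeriv U (h i) + h i)
          - ((k + 1 : ℕ) : ℝ) • (∑ i, uCoord U i * h i) + ∑ i, uCoord U i * p i := by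
        rw [Finset.smul_sum, ← Finset.sum_sub_distrib, ← Finset.sum_add_distrib]
        refine Finset.sum_congr rfl fun i _ => ?_
        rw [he i, Nat.cast_succ, add_smul, one_smul, mul_add, mul_sub, mul_smul_comm, mul_add]
        abel
      rw [map_add, Derivation.map_algebraMap, map_sum, smul_add, hc, hs]
      simp only [eulerDeriv_uCoord_mul]
      abel

/-- The eigenvalue k of E has no Jordan block. Differentiating by u_i lowers k by one, down to the
operator E + 1, which is injective by the radial argument. A function whose partial derivatives ∂_i
all vanish is killed by E, which brings the conclusion back from the derivatives to f. -/
theorem eulerDeriv_sub_smul_eq_zero (k : ℕ) {f : Smooth U} (hf : derivT U f = 0)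
    (h : eulerDeriv U (eulerDeriv U f - (k : ℝ) • f) - (k : ℝ) • (eulerDeriv U f - (k : ℝ) • f)
      = 0) : eulerDeriv U f - (k : ℝ) • f = 0 := by
  have hcomm : ∀ (c : ℝ) (g : Smooth U) i, derivU U i (eulerDeriv U g - c • g)
      = eulerDeriv U (derivU U i g) - (c - 1) • derivU U i g := by
    intro c g i
    rw [map_sub, derivU_eulerDeriv, Derivation.map_smul, sub_smul, one_smul]
    abel
  have hd : ∀ i, eulerDeriv U (derivU U i (eulerDeriv U f - (k : ℝ) • f))
      - ((k : ℝ) - 1) • derivU U i (eulerDeriv U f - (k : ℝ) • f) = 0 := fun i => by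
    rw [← hcomm, h, map_zero]
  induction k generalizing f with
  | zero =>
    have hzero : ∀ i, derivU U i f = 0 := by
      intro i
      have h1 := hd i
      rw [hcomm] at h1
      simp only [Nat.cast_zero, zero_sub, neg_smul, one_smul, sub_neg_eq_add] at h1
      have hti := derivT_derivU_eq_zero hf i
      -- Here (E + 1)² (∂_i f) = 0, so injectivity of E + 1 is applied twice.
      refine eq_zero_of_eulerDeriv_add_self hfib hstar hti ?_
      refine eq_zero_of_eulerDeriv_add_self hfib hstar ?_ h1
      rw [map_add, derivT_eulerDeriv, hti, map_zero, add_zero]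
    rw [eulerDeriv_apply]
    simp [hzero]
  | succ k ih =>
    have hzero : ∀ i, derivU U i (eulerDeriv U f - ((k + 1 : ℕ) : ℝ) • f) = 0 := by
      intro i
      have h1 := hd i
      rw [hcomm] at h1 ⊢
      simp only [Nat.cast_add, Nat.cast_one, add_sub_cancel_right] at h1 ⊢
      refine ih (derivT_derivU_eq_zero hf i) h1 fun j => ?_
      have h2 := congrArg (derivU U j) h1
      rwa [hcomm, map_zero] at h2
    have hE : eulerDeriv U (eulerDeriv U f - ((k + 1 : ℕ) : ℝ) • f) = 0 := by
      rw [eulerDeriv_apply]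
      exact Finset.sum_eq_zero fun i _ => by rw [hzero, mul_zero]
    -- With E (E - (k + 1)) f = 0, the hypothesis reduces to (k + 1) (E - (k + 1)) f = 0.
    rw [hE, zero_sub, neg_eq_zero] at h
    have hk : ((k + 1 : ℕ) : ℝ) ≠ 0 := by positivity
    have h2 := congrArg (fun g => (((k + 1 : ℕ) : ℝ))⁻¹ • g) h
    simpa only [smul_smul, inv_mul_cancel₀ hk, one_smul, smul_zero] using h2

end Decomposition

/-! ### Taylor parts at a point over u = 0. -/

section Taylor

/-- Evaluation of functions at a point. -/
def evalAt (x : U) : Smooth U →ₗ[ℝ] ℝ where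
  toFun f := f.1 x
  map_add' _ _ := rfl
  map_smul' _ _ := rfl

/-- The part of degree `k` in `u` of the Taylor expansion at the point `x₀`. -/
def taylorPart (x₀ : U) : ℕ → Smooth U →ₗ[ℝ] Smooth U
  | 0 => Algebra.linearMap ℝ (Smooth U) ∘ₗ evalAt x₀
  | k + 1 => ((k : ℝ) + 1)⁻¹ • ∑ i, LinearMap.mulLeft ℝ (uCoord U i) ∘ₗ taylorPart x₀ k ∘ₗ
      (derivU U i).toLinearMap

variable (x₀ : U)

theorem taylorPart_zero (f : Smooth U) : taylorPart x₀ 0 f = algebraMap ℝ _ (f.1 x₀) := rfl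

theorem taylorPart_succ (k : ℕ) (f : Smooth U) : taylorPart x₀ (k + 1) f
    = ((k : ℝ) + 1)⁻¹ • ∑ i, uCoord U i * taylorPart x₀ k (derivU U i f) := by
  simp only [taylorPart, LinearMap.smul_apply, LinearMap.sum_apply]
  rfl

theorem taylorPart_mem (k : ℕ) (f : Smooth U) : taylorPart x₀ k f ∈ homogeneousPoly U k := by
  induction k generalizing f with
  | zero => exact algebraMap_mem_homogeneousPoly _
  | succ k ih =>
    rw [taylorPart_succ]
    exact Submodule.smul_mem _ _ (Submodule.sum_mem _ fun i _ => uCoord_mul_mem (ih _) i)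

variable {x₀} (hx₀ : (x₀ : ℝ × (Fin m → ℝ)).2 = 0)

include hx₀

theorem taylorPart_zero_uCoord_mul (i : Fin m) (f : Smooth U) :
    taylorPart x₀ 0 (uCoord U i * f) = 0 := by
  have h : (uCoord U i * f).1 x₀ = 0 := by
    change (x₀ : ℝ × (Fin m → ℝ)).2 i * f.1 x₀ = 0
    rw [hx₀, Pi.zero_apply, zero_mul]
  rw [taylorPart_zero, h, map_zero]

/-- Multiplication by u_j shifts the Taylor expansion by one degree, because u_j vanishes at the
base point. This is what makes the Taylor projection linear over the fields u_i ∂_{u_j}. -/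
theorem taylorPart_uCoord_mul (k : ℕ) (j : Fin m) (f : Smooth U) :
    taylorPart x₀ (k + 1) (uCoord U j * f) = uCoord U j * taylorPart x₀ k f := by
  have hsum : ∀ k f, ∑ i, uCoord U i * taylorPart x₀ k (if i = j then f else 0)
      = uCoord U j * taylorPart x₀ k f := by
    intro k f
    rw [Finset.sum_eq_single j]
    · rw [if_pos rfl]
    · intro i _ hi
      rw [if_neg hi, map_zero, mul_zero]
    · simp
  induction k generalizing f with
  | zero =>
    rw [taylorPart_succ]
    simp only [derivU_uCoord_mul, map_add, mul_add, Finset.sum_add_distrib, hsum,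
      taylorPart_zero_uCoord_mul hx₀]
    simp
  | succ k ih =>
    rw [taylorPart_succ]
    simp only [derivU_uCoord_mul, map_add, mul_add, Finset.sum_add_distrib, hsum, ih]
    have h1 : ∑ i, uCoord U i * (uCoord U j * taylorPart x₀ k (derivU U i f))
        = ((k : ℝ) + 1) • (uCoord U j * taylorPart x₀ (k + 1) f) := by
      have hk : (k : ℝ) + 1 ≠ 0 := by positivity
      rw [taylorPart_succ, mul_smul_comm, smul_smul, mul_inv_cancel₀ hk, one_smul, Finset.mul_sum]
      exact Finset.sum_congr rfl fun i _ => by ring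
    have hk : (k : ℝ) + 1 + 1 ≠ 0 := by positivity
    rw [h1]
    -- The Leibniz rule contributes weights 1 and k + 1. Their sum k + 2 cancels the factor in the
    -- recursion.
    nth_rewrite 1 [← one_smul ℝ (uCoord U j * taylorPart x₀ (k + 1) f)]
    rw [← add_smul, smul_smul, Nat.cast_succ, add_comm 1 ((k : ℝ) + 1), inv_mul_cancel₀ hk,
      one_smul]

/-- Euler's identity: applied to E f = ∑ u_i ∂_i f, the preceding shift rule yields the recursion
for the Taylor part without its factor 1 / k. In degree 0 both sides vanish. -/
theorem taylorPart_eulerDeriv (k : ℕ) (f : Smooth U) :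
    taylorPart x₀ k (eulerDeriv U f) = (k : ℝ) • taylorPart x₀ k f := by
  rw [eulerDeriv_apply, map_sum]
  cases k with
  | zero => simp [taylorPart_zero_uCoord_mul hx₀]
  | succ k =>
    have hk : (k : ℝ) + 1 ≠ 0 := by positivity
    simp only [taylorPart_uCoord_mul hx₀]
    rw [taylorPart_succ, Nat.cast_succ, smul_smul, mul_inv_cancel₀ hk, one_smul]

end Taylor

end Polynomials

/-! ### Homotopy formulas for the book differential and removal of t. -/

section Homotopy

variable {m : ℕ}

/-- Contraction of constant multivectors with `du_i`. -/
abbrev contractDu (i : Fin m) : ExteriorAlgebra ℝ (ℝ × (Fin m → ℝ)) →ₗ[ℝ]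
    ExteriorAlgebra ℝ (ℝ × (Fin m → ℝ)) :=
  CliffordAlgebra.contractLeft ((coordBasis m).coord (Sum.inr i))

/-- Contraction of constant multivectors with `dt`. -/
abbrev contractDt : ExteriorAlgebra ℝ (ℝ × (Fin m → ℝ)) →ₗ[ℝ]
    ExteriorAlgebra ℝ (ℝ × (Fin m → ℝ)) :=
  CliffordAlgebra.contractLeft ((coordBasis m).coord (Sum.inl ()))

/-- The operator that multiplies a product of coordinate vectors by the number of factors of the
form `∂_{u_i}`. -/
def verticalNumber (m : ℕ) : ExteriorAlgebra ℝ (ℝ × (Fin m → ℝ)) →ₗ[ℝ]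
    ExteriorAlgebra ℝ (ℝ × (Fin m → ℝ)) :=
  ∑ i, LinearMap.mulLeft ℝ (ExteriorAlgebra.ι ℝ (0, Pi.single i 1)) ∘ₗ contractDu i

theorem verticalNumber_apply (w : ExteriorAlgebra ℝ (ℝ × (Fin m → ℝ))) :
    verticalNumber m w = ∑ i, ExteriorAlgebra.ι ℝ (0, Pi.single i 1) * contractDu i w := by
  simp only [verticalNumber, LinearMap.sum_apply]
  rfl

theorem contractDu_ι_mul (i : Fin m) (v : ℝ × (Fin m → ℝ))
    (w : ExteriorAlgebra ℝ (ℝ × (Fin m → ℝ))) :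
    contractDu i (ExteriorAlgebra.ι ℝ v * w)
      = v.2 i • w - ExteriorAlgebra.ι ℝ v * contractDu i w := by
  rw [contractDu, CliffordAlgebra.contractLeft_ι_mul, coordBasis_coord_inr]

theorem contractDt_ι_mul (v : ℝ × (Fin m → ℝ)) (w : ExteriorAlgebra ℝ (ℝ × (Fin m → ℝ))) :
    contractDt (ExteriorAlgebra.ι ℝ v * w)
      = v.1 • w - ExteriorAlgebra.ι ℝ v * contractDt w := by
  rw [contractDt, CliffordAlgebra.contractLeft_ι_mul, coordBasis_coord_inl]

theorem contractDt_verticalNumber (w : ExteriorAlgebra ℝ (ℝ × (Fin m → ℝ))) :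
    contractDt (verticalNumber m w) = verticalNumber m (contractDt w) := by
  simp only [verticalNumber_apply, map_sum, contractDt_ι_mul, zero_smul, zero_sub]
  refine Finset.sum_congr rfl fun i _ => ?_
  rw [contractDt, contractDu, CliffordAlgebra.contractLeft_comm, mul_neg, neg_neg]

theorem contractDu_verticalNumber (i : Fin m) (w : ExteriorAlgebra ℝ (ℝ × (Fin m → ℝ))) :
    contractDu i (verticalNumber m w) = contractDu i w + verticalNumber m (contractDu i w) := by
  simp only [verticalNumber_apply, map_sum, contractDu_ι_mul, Finset.sum_sub_distrib]
  rw [Finset.sum_eq_single i, Pi.single_eq_same, one_smul, sub_eq_add_neg,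
    ← Finset.sum_neg_distrib]
  · congr 1
    refine Finset.sum_congr rfl fun j _ => ?_
    rw [contractDu, contractDu, CliffordAlgebra.contractLeft_comm, mul_neg, neg_neg]
  · intro j _ hj
    rw [Pi.single_eq_of_ne hj.symm, zero_smul]
  · simp

theorem verticalNumber_one : verticalNumber m 1 = 0 := by
  simp [verticalNumber_apply, contractDu, CliffordAlgebra.contractLeft_one]

theorem ι_mul_ι_mul_swap (v v' : ℝ × (Fin m → ℝ)) (w : ExteriorAlgebra ℝ (ℝ × (Fin m → ℝ))) :
    ExteriorAlgebra.ι ℝ v * (ExteriorAlgebra.ι ℝ v' * w)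
      = -(ExteriorAlgebra.ι ℝ v' * (ExteriorAlgebra.ι ℝ v * w)) := by
  rw [← mul_assoc, ← mul_assoc, ← neg_mul,
    eq_neg_of_add_eq_zero_left (ExteriorAlgebra.ι_add_mul_swap v v')]

/-- The number operator is the even derivation that extends the projection v ↦ (0, v.2). Hence words
in coordinate vectors are its eigenvectors. -/
theorem verticalNumber_ι_mul (v : ℝ × (Fin m → ℝ)) (w : ExteriorAlgebra ℝ (ℝ × (Fin m → ℝ))) :
    verticalNumber m (ExteriorAlgebra.ι ℝ v * w)
      = ExteriorAlgebra.ι ℝ (0, v.2) * w + ExteriorAlgebra.ι ℝ v * verticalNumber m w := by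
  have h : ((0, v.2) : ℝ × (Fin m → ℝ))
      = ∑ i, v.2 i • ((0, Pi.single i 1) : ℝ × (Fin m → ℝ)) := by
    ext j
    · simp [Prod.fst_sum]
    · simp [Prod.snd_sum, Pi.single_apply]
  simp only [verticalNumber_apply, contractDu_ι_mul, Finset.mul_sum]
  rw [h, map_sum, Finset.sum_mul, ← Finset.sum_add_distrib]
  refine Finset.sum_congr rfl fun i _ => ?_
  rw [mul_sub, ι_mul_ι_mul_swap v, map_smul, smul_mul_assoc, mul_smul_comm, sub_eq_add_neg]

variable {U : Opens (ℝ × (Fin m → ℝ))}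

theorem eulerField_mul_tmul (f : Smooth U) (w : ExteriorAlgebra ℝ (ℝ × (Fin m → ℝ))) :
    eulerField U * (f ⊗ₜ w)
      = ∑ i, (uCoord U i * f) ⊗ₜ[ℝ] (ExteriorAlgebra.ι ℝ (0, Pi.single i 1) * w) := by
  simp only [eulerField, Finset.sum_mul, linearField_eq, Algebra.TensorProduct.tmul_mul_tmul]

theorem partialT_mul_tmul (f : Smooth U) (w : ExteriorAlgebra ℝ (ℝ × (Fin m → ℝ))) :
    partialT U * (f ⊗ₜ w) = f ⊗ₜ[ℝ] (ExteriorAlgebra.ι ℝ (1, 0) * w) := by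
  rw [partialT, Algebra.TensorProduct.tmul_mul_tmul, one_mul]

theorem linearField_mul_tmul (i j : Fin m) (f : Smooth U)
    (w : ExteriorAlgebra ℝ (ℝ × (Fin m → ℝ))) : linearField U i j * (f ⊗ₜ w)
      = (uCoord U i * f) ⊗ₜ[ℝ] (ExteriorAlgebra.ι ℝ (0, Pi.single j 1) * w) := by
  rw [linearField_eq, Algebra.TensorProduct.tmul_mul_tmul]

theorem lieEuler_tmul (f : Smooth U) (w : ExteriorAlgebra ℝ (ℝ × (Fin m → ℝ))) :
    lieEuler U (f ⊗ₜ w) = eulerDeriv U f ⊗ₜ[ℝ] w - f ⊗ₜ[ℝ] verticalNumber m w := by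
  simp only [lieEuler, LinearMap.sum_apply, LinearMap.sub_apply, LinearMap.comp_apply,
    LinearMap.mulLeft_apply, coeffDeriv_tmul, contractL_tmul, partialU,
    Algebra.TensorProduct.tmul_mul_tmul, one_mul, Finset.sum_sub_distrib, eulerDeriv_apply,
    verticalNumber_apply, TensorProduct.sum_tmul, TensorProduct.tmul_sum]

variable (U)

/-- The divergence with respect to the variables `u_i`. -/
def divergence : Multivector U →ₗ[ℝ] Multivector U :=
  ∑ i, contractL U ((coordBasis m).coord (Sum.inr i)) ∘ₗ coeffDeriv U (0, Pi.single i 1)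

/-- Contraction with `dt`. -/
abbrev contractT : Multivector U →ₗ[ℝ] Multivector U :=
  contractL U ((coordBasis m).coord (Sum.inl ()))

variable {U}

theorem divergence_tmul (f : Smooth U) (w : ExteriorAlgebra ℝ (ℝ × (Fin m → ℝ))) :
    divergence U (f ⊗ₜ w) = ∑ i, derivU U i f ⊗ₜ[ℝ] contractDu i w := by
  simp only [divergence, LinearMap.sum_apply]
  rfl

theorem contractT_partialT_mul (x : Multivector U) :
    contractT U (partialT U * x) = x - partialT U * contractT U x := by
  induction x using TensorProduct.induction_on with
  | zero => simp
  | add x y hx hy => simp only [map_add, mul_add, hx, hy]; abel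
  | tmul f w =>
    rw [contractL_tmul, partialT_mul_tmul, partialT_mul_tmul, contractL_tmul]
    change f ⊗ₜ[ℝ] contractDt _ = _
    rw [contractDt_ι_mul, one_smul, TensorProduct.tmul_sub]

theorem contractT_eulerField_mul (x : Multivector U) :
    contractT U (eulerField U * x) = -(eulerField U * contractT U x) := by
  induction x using TensorProduct.induction_on with
  | zero => simp
  | add x y hx hy => simp only [map_add, mul_add, hx, hy]; abel
  | tmul f w =>
    rw [contractL_tmul, eulerField_mul_tmul, eulerField_mul_tmul, map_sum,
      ← Finset.sum_neg_distrib]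
    refine Finset.sum_congr rfl fun i _ => ?_
    have h := contractDt_ι_mul (0, Pi.single i 1) w
    rw [zero_smul, zero_sub] at h
    rw [contractL_tmul, ← TensorProduct.tmul_neg]
    exact congrArg _ h

theorem contractT_lieEuler (x : Multivector U) :
    contractT U (lieEuler U x) = lieEuler U (contractT U x) := by
  induction x using TensorProduct.induction_on with
  | zero => simp
  | add x y hx hy => simp only [map_add, hx, hy]
  | tmul f w =>
    rw [lieEuler_tmul, map_sub, contractL_tmul, contractL_tmul, contractL_tmul, lieEuler_tmul]
    congr 2
    exact contractDt_verticalNumber w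

theorem contractT_coeffDeriv (v : ℝ × (Fin m → ℝ)) (x : Multivector U) :
    contractT U (coeffDeriv U v x) = coeffDeriv U v (contractT U x) := by
  induction x using TensorProduct.induction_on with
  | zero => simp
  | add x y hx hy => simp only [map_add, hx, hy]
  | tmul f w => rfl

theorem lieEuler_partialT_mul (x : Multivector U) :
    lieEuler U (partialT U * x) = partialT U * lieEuler U x := by
  induction x using TensorProduct.induction_on with
  | zero => simp
  | add x y hx hy => simp only [map_add, mul_add, hx, hy]
  | tmul f w =>
    have h0 : ((0, ((1, 0) : ℝ × (Fin m → ℝ)).2) : ℝ × (Fin m → ℝ)) = 0 := rfl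
    rw [partialT_mul_tmul, lieEuler_tmul, lieEuler_tmul, mul_sub, partialT_mul_tmul,
      partialT_mul_tmul, verticalNumber_ι_mul, h0, map_zero, zero_mul, zero_add]

theorem divergence_partialT_mul (x : Multivector U) :
    divergence U (partialT U * x) = -(partialT U * divergence U x) := by
  induction x using TensorProduct.induction_on with
  | zero => simp
  | add x y hx hy => simp only [map_add, mul_add, hx, hy]; abel
  | tmul f w =>
    rw [partialT_mul_tmul, divergence_tmul, divergence_tmul, Finset.mul_sum,
      ← Finset.sum_neg_distrib]
    refine Finset.sum_congr rfl fun i _ => ?_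
    rw [contractDu_ι_mul, partialT_mul_tmul, ← TensorProduct.tmul_neg]
    simp

/-- In ∑ ∂_j (u_i f) ⊗ du_j ⌋ (∂_{u_i} ∧ w) the terms in which exactly one of the two operators hits
E add up to L x. Those in which both do contribute once for each i, which is the source of m. The
remaining ones give -E ∧ div x. -/
theorem divergence_eulerField_mul (x : Multivector U) :
    divergence U (eulerField U * x)
      = lieEuler U x + (m : ℝ) • x - eulerField U * divergence U x := by
  induction x using TensorProduct.induction_on with
  | zero => simp
  | add x y hx hy => simp only [map_add, mul_add, smul_add, hx, hy]; abel
  | tmul f w =>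
    have h : ∀ i j : Fin m, derivU U j (uCoord U i * f) ⊗ₜ[ℝ]
        contractDu j (ExteriorAlgebra.ι ℝ (0, Pi.single i 1) * w)
        = (if i = j then (f ⊗ₜ w + (uCoord U i * derivU U i f) ⊗ₜ w
            - f ⊗ₜ[ℝ] (ExteriorAlgebra.ι ℝ (0, Pi.single i 1) * contractDu i w)) else 0)
          - (uCoord U i * derivU U j f) ⊗ₜ[ℝ]
            (ExteriorAlgebra.ι ℝ (0, Pi.single i 1) * contractDu j w) := by
      intro i j
      rw [derivU_uCoord_mul, contractDu_ι_mul]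
      by_cases hij : i = j
      · subst hij
        simp only [if_true, Pi.single_eq_same, one_smul, TensorProduct.add_tmul,
          TensorProduct.tmul_sub]
        abel
      · simp only [if_neg hij, if_neg (Ne.symm hij), Pi.single_eq_of_ne (Ne.symm hij), zero_add,
          zero_smul, zero_sub, TensorProduct.tmul_neg]
    rw [eulerField_mul_tmul, map_sum]
    simp only [divergence_tmul, h, Finset.sum_sub_distrib, Finset.mul_sum, eulerField_mul_tmul,
      Finset.sum_ite_eq, Finset.mem_univ, if_true, Finset.sum_add_distrib, lieEuler_tmul,
      eulerDeriv_apply, verticalNumber_apply, TensorProduct.sum_tmul, TensorProduct.tmul_sum,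
      Finset.sum_const, Finset.card_univ, Fintype.card_fin, Nat.cast_smul_eq_nsmul]
    rw [Finset.sum_comm (γ := Fin m)]
    abel

theorem divergence_coeffDeriv (x : Multivector U) :
    divergence U (coeffDeriv U (1, 0) x) = coeffDeriv U (1, 0) (divergence U x) := by
  induction x using TensorProduct.induction_on with
  | zero => simp
  | add x y hx hy => simp only [map_add, hx, hy]
  | tmul f w =>
    rw [coeffDeriv_tmul, divergence_tmul, divergence_tmul, map_sum]
    refine Finset.sum_congr rfl fun i _ => ?_
    rw [coeffDeriv_tmul, dirDeriv_comm]

/-- Each ∂_i lowers the degree of the coefficient by one, and each contraction with du_i lowers the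
number of factors ∂_{u_i} by one. The two shifts cancel in E - k. -/
theorem divergence_lieEuler (x : Multivector U) :
    divergence U (lieEuler U x) = lieEuler U (divergence U x) := by
  induction x using TensorProduct.induction_on with
  | zero => simp
  | add x y hx hy => simp only [map_add, hx, hy]
  | tmul f w =>
    rw [lieEuler_tmul, map_sub, divergence_tmul, divergence_tmul, divergence_tmul, map_sum,
      ← Finset.sum_sub_distrib]
    refine Finset.sum_congr rfl fun i _ => ?_
    rw [lieEuler_tmul, derivU_eulerDeriv, contractDu_verticalNumber, TensorProduct.add_tmul,
      TensorProduct.tmul_add]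
    abel

/-- Cartan's formula for the Euler field, the Hamiltonian vector field of `t`. -/
theorem bookDiff_contractT (x : Multivector U) :
    bookDiff U (contractT U x) = lieEuler U x - contractT U (bookDiff U x) := by
  rw [bookDiff_apply, bookDiff_apply, map_sub, contractT_partialT_mul, contractT_eulerField_mul,
    contractT_lieEuler, contractT_coeffDeriv]
  abel

/-- The second homotopy formula. The divergence anticommutes with ∂_t ∧ and commutes with L and D,
so only its failure to anticommute with E ∧ survives, namely L + m. -/
theorem bookDiff_divergence (x : Multivector U) :
    bookDiff U (divergence U x) = -(lieEuler U (coeffDeriv U (1, 0) x)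
      + (m : ℝ) • coeffDeriv U (1, 0) x) - divergence U (bookDiff U x) := by
  rw [bookDiff_apply, bookDiff_apply, map_sub, divergence_partialT_mul, divergence_eulerField_mul,
    divergence_lieEuler, divergence_coeffDeriv]
  abel

theorem coeffDeriv_partialT_mul (x : Multivector U) :
    coeffDeriv U (1, 0) (partialT U * x) = partialT U * coeffDeriv U (1, 0) x := by
  rw [coeffDeriv_mul, partialT, coeffDeriv_tmul, Derivation.map_one_eq_zero,
    TensorProduct.zero_tmul, zero_mul, zero_add]

theorem coeffDeriv_eulerField_mul (x : Multivector U) :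
    coeffDeriv U (1, 0) (eulerField U * x) = eulerField U * coeffDeriv U (1, 0) x := by
  have h : coeffDeriv U (1, 0) (eulerField U) = 0 := by
    rw [eulerField, map_sum]
    refine Finset.sum_eq_zero fun i _ => ?_
    rw [linearField_eq, coeffDeriv_tmul, dirDeriv_uCoord]
    simp
  rw [coeffDeriv_mul, h, zero_mul, zero_add]

theorem coeffDeriv_bookDiff (x : Multivector U) :
    coeffDeriv U (1, 0) (bookDiff U x) = bookDiff U (coeffDeriv U (1, 0) x) := by
  rw [bookDiff_apply, bookDiff_apply, map_sub, coeffDeriv_partialT_mul,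
    coeffDeriv_eulerField_mul, coeffDeriv_lieEuler]

theorem coeffDeriv_surjective
    (hfib : ∀ u : Fin m → ℝ, IsPreconnected {x : ℝ × (Fin m → ℝ) | x ∈ U ∧ x.2 = u}) :
    Function.Surjective (coeffDeriv U (1, 0)) :=
  LinearMap.rTensor_surjective _ (derivT_surjective hfib)

/-- Every closed multivector field is cohomologous to one that does not depend on `t`. -/
theorem exists_coeffDeriv_eq_zero (hm : m ≠ 0)
    (hfib : ∀ u : Fin m → ℝ, IsPreconnected {x : ℝ × (Fin m → ℝ) | x ∈ U ∧ x.2 = u})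
    {x : Multivector U} (hx : bookDiff U x = 0) :
    ∃ y, coeffDeriv U (1, 0) (x - bookDiff U y) = 0 := by
  obtain ⟨w, hw⟩ := coeffDeriv_surjective hfib x
  have hm' : (m : ℝ) ≠ 0 := Nat.cast_ne_zero.mpr hm
  have hx' : bookDiff U (coeffDeriv U (1, 0) x) = 0 := by rw [← coeffDeriv_bookDiff, hx, map_zero]
  -- With D w = x, moving D inside gives div x + ι (D x). By the two homotopy formulas and
  -- closedness of x and D x, the differential is -(L + m) D x + L D x.
  have key : bookDiff U (coeffDeriv U (1, 0) (divergence U w + contractT U x))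
      = -((m : ℝ) • coeffDeriv U (1, 0) x) := by
    rw [map_add, ← divergence_coeffDeriv, hw, ← contractT_coeffDeriv, map_add, bookDiff_divergence,
      bookDiff_contractT, hx, hx', map_zero, map_zero]
    abel
  refine ⟨-((m : ℝ)⁻¹ • (divergence U w + contractT U x)), ?_⟩
  rw [map_sub, coeffDeriv_bookDiff, map_neg, map_neg, map_smul, map_smul, key, smul_neg,
    smul_smul, inv_mul_cancel₀ hm', one_smul, neg_neg, sub_self]

end Homotopy

/-- The first isomorphism theorem for two-sided ideals. -/
theorem exists_ringEquiv_of_ker_eq {A B : Type*} [Ring A] [Ring B] [Algebra ℝ A] [Algebra ℝ B]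
    (f : A →ₐ[ℝ] B) (hf : Function.Surjective f) {I : TwoSidedIdeal A}
    (h : TwoSidedIdeal.ker f = I) :
    ∃ φ : I.ringCon.Quotient ≃+* B, ∀ a, φ (I.ringCon.mk' a) = f a := by
  subst h
  exact ⟨RingCon.quotientKerEquivOfSurjective (f : A →+* B) hf, fun _ => rfl⟩

/-! ### Words in coordinate vectors and coefficientwise operators. -/

section Words

variable {m : ℕ}

/-- Wedge product of a list of coordinate vectors. -/
def coordWord (l : List (Unit ⊕ Fin m)) : ExteriorAlgebra ℝ (ℝ × (Fin m → ℝ)) :=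
  (l.map fun a => ExteriorAlgebra.ι ℝ (coordBasis m a)).prod

theorem coordWord_nil : coordWord ([] : List (Unit ⊕ Fin m)) = 1 := rfl

theorem coordWord_cons (a : Unit ⊕ Fin m) (l : List (Unit ⊕ Fin m)) :
    coordWord (a :: l) = ExteriorAlgebra.ι ℝ (coordBasis m a) * coordWord l := by
  simp [coordWord]

/-- The number of factors `∂_{u_i}` of a word. -/
def height (l : List (Unit ⊕ Fin m)) : ℕ := l.countP Sum.isRight

theorem height_cons_inl (l : List (Unit ⊕ Fin m)) : height (Sum.inl () :: l) = height l := by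
  simp [height]

theorem height_cons_inr (i : Fin m) (l : List (Unit ⊕ Fin m)) :
    height (Sum.inr i :: l) = height l + 1 :=
  List.countP_cons_of_pos rfl

theorem verticalNumber_coordWord (l : List (Unit ⊕ Fin m)) :
    verticalNumber m (coordWord l) = (height l : ℝ) • coordWord l := by
  induction l with
  | nil => simp [coordWord_nil, verticalNumber_one, height]
  | cons a l ih =>
    rw [coordWord_cons, verticalNumber_ι_mul, ih, mul_smul_comm]
    rcases a with ⟨⟩ | i
    · have h0 : ((0, ((1, 0) : ℝ × (Fin m → ℝ)).2) : ℝ × (Fin m → ℝ)) = 0 := rfl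
      rw [height_cons_inl, coordBasis_inl, h0, map_zero, zero_mul, zero_add]
    · rw [height_cons_inr, coordBasis_inr, Nat.cast_succ, add_smul, one_smul, add_comm]

theorem ι_mul_mem {S : Submodule ℝ (ExteriorAlgebra ℝ (ℝ × (Fin m → ℝ)))}
    {x : ExteriorAlgebra ℝ (ℝ × (Fin m → ℝ))}
    (h : ∀ a, ExteriorAlgebra.ι ℝ (coordBasis m a) * x ∈ S) (v : ℝ × (Fin m → ℝ)) :
    ExteriorAlgebra.ι ℝ v * x ∈ S := by
  rw [← (coordBasis m).sum_repr v, map_sum, Finset.sum_mul]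
  refine Submodule.sum_mem _ fun a _ => ?_
  rw [map_smul, smul_mul_assoc]
  exact S.smul_mem _ (h a)

/-- Two sets of words are allowed so that the argument serves both the whole exterior algebra and
the passage from degree k to k + 1. -/
theorem ι_mul_mem_span {L L' : Set (List (Unit ⊕ Fin m))} (hL : ∀ a, ∀ l ∈ L, a :: l ∈ L')
    (v : ℝ × (Fin m → ℝ)) {x : ExteriorAlgebra ℝ (ℝ × (Fin m → ℝ))}
    (hx : x ∈ Submodule.span ℝ (coordWord '' L)) :
    ExteriorAlgebra.ι ℝ v * x ∈ Submodule.span ℝ (coordWord '' L') := by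
  induction hx using Submodule.span_induction with
  | mem x hx =>
    obtain ⟨l, hl, rfl⟩ := hx
    refine ι_mul_mem (fun a => ?_) v
    rw [← coordWord_cons]
    exact Submodule.subset_span ⟨_, hL a l hl, rfl⟩
  | zero => rw [mul_zero]; exact Submodule.zero_mem _
  | add x y _ _ hx hy => rw [mul_add]; exact Submodule.add_mem _ hx hy
  | smul r x _ hx => rw [mul_smul_comm]; exact Submodule.smul_mem _ _ hx

theorem span_coordWord : ⊤ ≤ Submodule.span ℝ (Set.range (coordWord (m := m))) := by
  rw [← Set.image_univ]
  rintro x -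
  induction x using CliffordAlgebra.left_induction with
  | algebraMap r =>
    rw [Algebra.algebraMap_eq_smul_one]
    exact Submodule.smul_mem _ _ (Submodule.subset_span ⟨[], trivial, coordWord_nil⟩)
  | add x y hx hy => exact Submodule.add_mem _ hx hy
  | ι_mul x v hx => exact ι_mul_mem_span (fun _ _ _ => Set.mem_univ _) v hx

theorem exteriorPower_le_span_coordWord (k : ℕ) :
    ⋀[ℝ]^k (ℝ × (Fin m → ℝ))
      ≤ Submodule.span ℝ (coordWord '' {l : List (Unit ⊕ Fin m) | l.length = k}) := by
  induction k with
  | zero =>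
    rintro x hx
    have hx' : x ∈ LinearMap.range (ExteriorAlgebra.ι ℝ (M := ℝ × (Fin m → ℝ))) ^ 0 := hx
    rw [pow_zero] at hx'
    obtain ⟨r, rfl⟩ := Submodule.mem_one.mp hx'
    rw [Algebra.algebraMap_eq_smul_one]
    exact Submodule.smul_mem _ _ (Submodule.subset_span ⟨[], rfl, coordWord_nil⟩)
  | succ k ih =>
    rintro x hx
    have hx' : x ∈ LinearMap.range (ExteriorAlgebra.ι ℝ (M := ℝ × (Fin m → ℝ))) ^ (k + 1) := hx
    rw [pow_succ'] at hx'
    clear hx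
    induction hx' using Submodule.mul_induction_on' with
    | mem_mul_mem v hv w hw =>
      obtain ⟨v, rfl⟩ := hv
      exact ι_mul_mem_span (fun a l (hl : l.length = k) => by simp [hl]) v (ih hw)
    | add x _ y _ h1 h2 => exact Submodule.add_mem _ h1 h2

theorem coordWord_mem_exteriorPower (l : List (Unit ⊕ Fin m)) :
    coordWord l ∈ ⋀[ℝ]^l.length (ℝ × (Fin m → ℝ)) := by
  change _ ∈ LinearMap.range (ExteriorAlgebra.ι ℝ) ^ l.length
  induction l with
  | nil =>
    rw [List.length_nil, pow_zero]
    exact Submodule.mem_one.mpr ⟨1, map_one _⟩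
  | cons a l ih =>
    rw [coordWord_cons, List.length_cons, pow_succ']
    exact Submodule.mul_mem_mul ⟨_, rfl⟩ ih

/-- A basis of the exterior algebra that consists of words. -/
def wordBasis (m : ℕ) := Module.Basis.ofSpan (span_coordWord (m := m))

/-- Index type of `wordBasis`. -/
abbrev WordIndex (m : ℕ) : Type :=
  ((linearIndepOn_empty ℝ (id : ExteriorAlgebra ℝ (ℝ × (Fin m → ℝ)) → _)).extend
    (Set.empty_subset (Set.range (coordWord (m := m)))) : Set _)

theorem exists_wordBasis_eq (i : WordIndex m) : ∃ l, coordWord l = wordBasis m i :=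
  Module.Basis.ofSpan_subset span_coordWord ⟨i, rfl⟩

/-- A word that represents a basis element. -/
def word (i : WordIndex m) : List (Unit ⊕ Fin m) := (exists_wordBasis_eq i).choose

theorem wordBasis_apply (i : WordIndex m) : wordBasis m i = coordWord (word i) :=
  (exists_wordBasis_eq i).choose_spec.symm

variable {U : Opens (ℝ × (Fin m → ℝ))}

theorem multivector_induction {C : Multivector U → Prop} (h0 : C 0)
    (hadd : ∀ x y, C x → C y → C (x + y))
    (hword : ∀ (f : Smooth U) (l : List (Unit ⊕ Fin m)), C (f ⊗ₜ coordWord l))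
    (x : Multivector U) : C x := by
  induction x using TensorProduct.induction_on with
  | zero => exact h0
  | add x y hx hy => exact hadd x y hx hy
  | tmul f w =>
    have hw : w ∈ Submodule.span ℝ (Set.range (coordWord (m := m))) := span_coordWord trivial
    induction hw using Submodule.span_induction generalizing f with
    | mem w hw => obtain ⟨l, rfl⟩ := hw; exact hword f l
    | zero => rw [TensorProduct.tmul_zero]; exact h0
    | add x y _ _ hx hy => rw [TensorProduct.tmul_add]; exact hadd _ _ (hx f) (hy f)
    | smul r x _ hx => rw [← TensorProduct.smul_tmul]; exact hx _

theorem lieEuler_tmul_coordWord (f : Smooth U) (l : List (Unit ⊕ Fin m)) :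
    lieEuler U (f ⊗ₜ coordWord l)
      = (eulerDeriv U f - (height l : ℝ) • f) ⊗ₜ[ℝ] coordWord l := by
  rw [lieEuler_tmul, verticalNumber_coordWord, TensorProduct.tmul_smul, TensorProduct.sub_tmul,
    TensorProduct.smul_tmul']

variable (U)

open Classical in
/-- The coefficients of a multivector field with respect to `wordBasis`. -/
def coeffs : Multivector U ≃ₗ[ℝ] (WordIndex m →₀ Smooth U) :=
  TensorProduct.equivFinsuppOfBasisRight (wordBasis m)

variable {U}

theorem coeffs_symm_single (i : WordIndex m) (f : Smooth U) :
    (coeffs U).symm (Finsupp.single i f) = f ⊗ₜ coordWord (word i) := by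
  classical
  rw [coeffs, TensorProduct.equivFinsuppOfBasisRight_symm_apply, Finsupp.sum_single_index,
    wordBasis_apply]
  exact TensorProduct.zero_tmul _ _

/-- Reduces statements about D and L to statements about the functions that are the coefficients of
a field. -/
theorem coeffs_map (T : Multivector U →ₗ[ℝ] Multivector U)
    (τ : WordIndex m → Smooth U →ₗ[ℝ] Smooth U)
    (h : ∀ i f, T (f ⊗ₜ coordWord (word i)) = τ i f ⊗ₜ coordWord (word i)) (x : Multivector U)
    (i : WordIndex m) : coeffs U (T x) i = τ i (coeffs U x i) := by
  classical
  obtain ⟨g, rfl⟩ := (coeffs U).symm.surjective x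
  induction g using Finsupp.induction_linear with
  | zero => simp
  | add g g' hg hg' =>
    simp only [map_add, Finsupp.add_apply, hg, hg']
  | single j f =>
    rw [coeffs_symm_single, h, ← coeffs_symm_single, ← coeffs_symm_single,
      LinearEquiv.apply_symm_apply, LinearEquiv.apply_symm_apply]
    by_cases hij : j = i
    · subst hij; simp
    · simp [Finsupp.single_eq_of_ne' hij]

theorem coeffs_coeffDeriv (v : ℝ × (Fin m → ℝ)) (x : Multivector U) (i : WordIndex m) :
    coeffs U (coeffDeriv U v x) i = dirDeriv U v (coeffs U x i) :=
  coeffs_map _ (fun _ => (dirDeriv U v).toLinearMap) (fun _ _ => rfl) x i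

theorem coeffs_lieEuler (x : Multivector U) (i : WordIndex m) :
    coeffs U (lieEuler U x) i
      = eulerDeriv U (coeffs U x i) - (height (word i) : ℝ) • coeffs U x i := by
  have h := coeffs_map (lieEuler U) (fun i => (eulerDeriv U : Smooth U →ₗ[ℝ] Smooth U)
    - (height (word i) : ℝ) • (LinearMap.id : Smooth U →ₗ[ℝ] Smooth U)) (fun i f => by
      rw [lieEuler_tmul_coordWord, LinearMap.sub_apply, LinearMap.smul_apply, LinearMap.id_apply]
      rfl) x i
  rw [LinearMap.sub_apply, LinearMap.smul_apply, LinearMap.id_apply] at h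
  exact h

theorem eq_sum_coeffs (x : Multivector U) :
    x = ∑ i ∈ (coeffs U x).support, coeffs U x i ⊗ₜ coordWord (word i) := by
  conv_lhs => rw [← (coeffs U).symm_apply_apply x, ← Finsupp.sum_single (coeffs U x),
    Finsupp.sum, map_sum]
  exact Finset.sum_congr rfl fun i _ => coeffs_symm_single i _

theorem homogeneousPoly_succ_induction {C : Smooth U → Prop} {k : ℕ} (h0 : C 0)
    (hadd : ∀ f g, C f → C g → C (f + g))
    (hmul : ∀ i, ∀ f ∈ homogeneousPoly U k, C (uCoord U i * f)) {f : Smooth U}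
    (hf : f ∈ homogeneousPoly U (k + 1)) : C f := by
  rw [homogeneousPoly, pow_succ'] at hf
  refine Submodule.mul_induction_on hf (fun x hx f hf => ?_) hadd
  induction hx using Submodule.span_induction generalizing f with
  | mem x hx => obtain ⟨i, rfl⟩ := hx; exact hmul i f hf
  | zero => rw [zero_mul]; exact h0
  | add x y _ _ h1 h2 => rw [add_mul]; exact hadd _ _ (h1 f hf) (h2 f hf)
  | smul r x _ h =>
    rw [smul_mul_assoc, ← mul_smul_comm]
    exact h _ (Submodule.smul_mem _ r hf)

theorem partialT_mem : partialT U ∈ linearFieldAlgebra U :=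
  Algebra.subset_adjoin (Submodule.subset_span (Or.inl rfl))

theorem linearField_mem (i j : Fin m) : linearField U i j ∈ linearFieldAlgebra U :=
  Algebra.subset_adjoin (Submodule.subset_span (Or.inr ⟨(i, j), rfl⟩))

/-- The degree of the coefficient equals the number of factors ∂_{u_j}, so each of these can be
paired with one linear factor u_i. -/
theorem tmul_coordWord_mem (l : List (Unit ⊕ Fin m)) {f : Smooth U}
    (hf : f ∈ homogeneousPoly U (height l)) : f ⊗ₜ coordWord l ∈ linearFieldAlgebra U := by
  induction l generalizing f with
  | nil =>
    have hf' : f ∈ homogeneousPoly U 0 := hf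
    rw [homogeneousPoly, pow_zero] at hf'
    obtain ⟨r, rfl⟩ := Submodule.mem_one.mp hf'
    rw [coordWord_nil]
    exact (linearFieldAlgebra U).algebraMap_mem r
  | cons a l ih =>
    rcases a with ⟨⟩ | j
    · rw [height_cons_inl] at hf
      rw [coordWord_cons, coordBasis_inl, ← partialT_mul_tmul]
      exact mul_mem partialT_mem (ih hf)
    · rw [height_cons_inr] at hf
      refine homogeneousPoly_succ_induction (C := fun f => f ⊗ₜ coordWord (Sum.inr j :: l)
        ∈ linearFieldAlgebra U) ?_ ?_ ?_ hf
      · rw [TensorProduct.zero_tmul]; exact zero_mem _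
      · intro f g hf hg; rw [TensorProduct.add_tmul]; exact add_mem hf hg
      · intro i f hf
        rw [coordWord_cons, coordBasis_inr, ← linearField_mul_tmul]
        exact mul_mem (linearField_mem i j) (ih hf)

/-! ### Representatives in the linear subalgebra. -/

section Representative

variable (hfib : ∀ u : Fin m → ℝ, IsPreconnected {x : ℝ × (Fin m → ℝ) | x ∈ U ∧ x.2 = u})
  (hstar : StarConvex ℝ (0 : Fin m → ℝ) (Prod.snd '' (U : Set (ℝ × (Fin m → ℝ)))))

include hfib hstar

/-- On each basis word L acts as E - k, with k the height, so the decomposition of functions is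
applied to each coefficient. -/
theorem exists_lieEuler_add {y : Multivector U} (hy : coeffDeriv U (1, 0) y = 0) :
    ∃ z, coeffDeriv U (1, 0) z = 0 ∧ ∃ p ∈ linearFieldAlgebra U, y = lieEuler U z + p := by
  have hc : ∀ i, derivT U (coeffs U y i) = 0 := fun i => by
    rw [← coeffs_coeffDeriv, hy, map_zero, Finsupp.zero_apply]
  choose g p hg hp he using fun i =>
    exists_eulerDeriv_sub_smul hfib hstar (height (word i)) (hc i)
  refine ⟨∑ i ∈ (coeffs U y).support, g i ⊗ₜ coordWord (word i), ?_,
    ∑ i ∈ (coeffs U y).support, p i ⊗ₜ coordWord (word i),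
    sum_mem fun i _ => tmul_coordWord_mem _ (hp i), ?_⟩
  · rw [map_sum]
    exact Finset.sum_eq_zero fun i _ => by rw [coeffDeriv_tmul, hg, TensorProduct.zero_tmul]
  · conv_lhs => rw [eq_sum_coeffs y]
    rw [map_sum, ← Finset.sum_add_distrib]
    refine Finset.sum_congr rfl fun i _ => ?_
    rw [lieEuler_tmul_coordWord, ← TensorProduct.add_tmul, ← he]

theorem lieEuler_eq_zero {z : Multivector U} (hz : coeffDeriv U (1, 0) z = 0)
    (h : lieEuler U (lieEuler U z) = 0) : lieEuler U z = 0 := by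
  refine (coeffs U).injective (Finsupp.ext fun i => ?_)
  rw [map_zero, Finsupp.zero_apply, coeffs_lieEuler]
  refine eulerDeriv_sub_smul_eq_zero hfib hstar _ ?_ ?_
  · rw [← coeffs_coeffDeriv, hz, map_zero, Finsupp.zero_apply]
  · rw [← coeffs_lieEuler, ← coeffs_lieEuler, h, map_zero, Finsupp.zero_apply]

/-- Every closed multivector field is cohomologous to an element of `linearFieldAlgebra`. -/
theorem exists_linearFieldAlgebra_add (hm : m ≠ 0) {x : Multivector U} (hx : bookDiff U x = 0) :
    ∃ p ∈ linearFieldAlgebra U, ∃ y, x = p + bookDiff U y := by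
  obtain ⟨y, hy⟩ := exists_coeffDeriv_eq_zero hm hfib hx
  obtain ⟨z, hz, p, hp, he⟩ := exists_lieEuler_add hfib hstar hy
  -- L z is closed, as the difference of closed fields, and independent of t, so its differential is
  -- just ∂_t ∧ L (L z).
  have hLz : partialT U * lieEuler U (lieEuler U z) = 0 := by
    have h1 : bookDiff U (lieEuler U z) = 0 := by
      have h2 : lieEuler U z = x - bookDiff U y - p := by rw [he]; abel
      have h3 : bookDiff U p = 0 := linearFieldAlgebra_le U hp
      rw [h2, map_sub, map_sub, hx, bookDiff_bookDiff, h3]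
      simp
    rwa [bookDiff_apply, coeffDeriv_lieEuler, hz, map_zero, mul_zero, sub_zero] at h1
  -- This element is L (ι (∂_t ∧ z)), and applying L once more gives ι (∂_t ∧ L (L z)) = 0. The
  -- absence of Jordan blocks yields the vanishing, and Cartan's formula becomes L z = d (ι z).
  have ha : contractT U (bookDiff U z) = 0 := by
    rw [bookDiff_apply, hz, mul_zero, sub_zero, ← lieEuler_partialT_mul, contractT_lieEuler]
    refine lieEuler_eq_zero hfib hstar ?_ ?_
    · rw [← contractT_coeffDeriv, coeffDeriv_partialT_mul, hz, mul_zero, map_zero]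
    · rw [← contractT_lieEuler, ← contractT_lieEuler, lieEuler_partialT_mul,
        lieEuler_partialT_mul, hLz, map_zero]
  refine ⟨p, hp, contractT U z + y, ?_⟩
  rw [map_add, bookDiff_contractT, ha, sub_zero]
  rw [sub_eq_iff_eq_add] at he
  rw [he]
  abel

end Representative

/-! ### The Taylor projection onto the linear subalgebra. -/

section Projection

variable (x₀ : U)

/-- The projection to `linearFieldAlgebra` that takes from the coefficients of `k` factors
`∂_{u_i}` the Taylor part of degree `k`. -/
def taylorProj : Multivector U →ₗ[ℝ] Multivector U :=
  (Finsupp.lsum ℝ fun i => (TensorProduct.mk ℝ (Smooth U) (ExteriorAlgebra ℝ _)).flip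
    (coordWord (word i)) ∘ₗ taylorPart x₀ (height (word i))) ∘ₗ (coeffs U).toLinearMap

theorem taylorProj_tmul_wordBasis (f : Smooth U) (i : WordIndex m) :
    taylorProj x₀ (f ⊗ₜ wordBasis m i)
      = taylorPart x₀ (height (word i)) f ⊗ₜ[ℝ] wordBasis m i := by
  rw [wordBasis_apply, ← coeffs_symm_single]
  simp [taylorProj]

/-- The projection is defined through a chosen basis of words. An eigenvector of the number operator
expands only in basis words whose height is its eigenvalue, so the formula holds for every word,
whether or not it belongs to the basis. -/
theorem taylorProj_tmul (f : Smooth U) {w : ExteriorAlgebra ℝ (ℝ × (Fin m → ℝ))} {k : ℕ}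
    (hw : verticalNumber m w = (k : ℝ) • w) :
    taylorProj x₀ (f ⊗ₜ w) = taylorPart x₀ k f ⊗ₜ[ℝ] w := by
  have hrepr : ∀ i, (wordBasis m).repr (verticalNumber m w) i
      = (height (word i) : ℝ) * (wordBasis m).repr w i := by
    intro i
    conv_lhs => rw [← (wordBasis m).linearCombination_repr w, Finsupp.linearCombination_apply,
      Finsupp.sum, map_sum]
    simp only [map_smul, wordBasis_apply, verticalNumber_coordWord]
    simp only [← wordBasis_apply, map_sum, map_smul, Module.Basis.repr_self, Finsupp.coe_finsetSum,
      Finset.sum_apply, Finsupp.smul_apply, smul_eq_mul]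
    rw [Finset.sum_eq_single i]
    · simp [mul_comm]
    · intro j _ hj
      simp [Finsupp.single_eq_of_ne' hj]
    · intro hi
      rw [Finsupp.notMem_support_iff.mp hi, zero_mul]
  have hheight : ∀ i ∈ ((wordBasis m).repr w).support, height (word i) = k := by
    intro i hi
    have h := hrepr i
    rw [hw, map_smul, Finsupp.smul_apply, smul_eq_mul] at h
    exact_mod_cast (mul_right_cancel₀ (Finsupp.mem_support_iff.mp hi) h).symm
  conv_lhs => rw [← (wordBasis m).linearCombination_repr w, Finsupp.linearCombination_apply,
    Finsupp.sum, TensorProduct.tmul_sum, map_sum]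
  conv_rhs => rw [← (wordBasis m).linearCombination_repr w, Finsupp.linearCombination_apply,
    Finsupp.sum, TensorProduct.tmul_sum]
  refine Finset.sum_congr rfl fun i hi => ?_
  rw [TensorProduct.tmul_smul, TensorProduct.tmul_smul, map_smul, taylorProj_tmul_wordBasis,
    hheight i hi]

theorem taylorProj_tmul_coordWord (f : Smooth U) (l : List (Unit ⊕ Fin m)) :
    taylorProj x₀ (f ⊗ₜ coordWord l) = taylorPart x₀ (height l) f ⊗ₜ[ℝ] coordWord l :=
  taylorProj_tmul x₀ f (verticalNumber_coordWord l)

theorem taylorProj_mem (x : Multivector U) : taylorProj x₀ x ∈ linearFieldAlgebra U := by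
  induction x using multivector_induction with
  | h0 => rw [map_zero]; exact zero_mem _
  | hadd x y hx hy => rw [map_add]; exact add_mem hx hy
  | hword f l =>
    rw [taylorProj_tmul_coordWord]
    exact tmul_coordWord_mem l (taylorPart_mem x₀ _ f)

theorem taylorProj_mem_multivectorsOfDegree {k : ℕ} {x : Multivector U}
    (hx : x ∈ multivectorsOfDegree U k) : taylorProj x₀ x ∈ multivectorsOfDegree U k := by
  obtain ⟨t, rfl⟩ := hx
  induction t using TensorProduct.induction_on with
  | zero => rw [map_zero, map_zero]; exact Submodule.zero_mem _
  | add x y hx hy => rw [map_add, map_add]; exact Submodule.add_mem _ hx hy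
  | tmul f a =>
    obtain ⟨a, ha⟩ := a
    change taylorProj x₀ (f ⊗ₜ a) ∈ _
    have ha' := exteriorPower_le_span_coordWord k ha
    clear ha
    induction ha' using Submodule.span_induction with
    | mem a ha =>
      obtain ⟨l, rfl, rfl⟩ := ha
      rw [taylorProj_tmul_coordWord]
      exact ⟨_ ⊗ₜ ⟨coordWord l, coordWord_mem_exteriorPower l⟩, rfl⟩
    | zero => rw [TensorProduct.tmul_zero, map_zero]; exact Submodule.zero_mem _
    | add x y _ _ hx hy => rw [TensorProduct.tmul_add, map_add]; exact Submodule.add_mem _ hx hy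
    | smul r x _ hx => rw [TensorProduct.tmul_smul, map_smul]; exact Submodule.smul_mem _ _ hx

theorem taylorProj_partialT_mul (x : Multivector U) :
    taylorProj x₀ (partialT U * x) = partialT U * taylorProj x₀ x := by
  induction x using multivector_induction with
  | h0 => simp
  | hadd x y hx hy => simp only [mul_add, map_add, hx, hy]
  | hword f l =>
    rw [taylorProj_tmul_coordWord, partialT_mul_tmul, partialT_mul_tmul,
      ← coordBasis_inl (m := m) (), ← coordWord_cons, taylorProj_tmul_coordWord, height_cons_inl]

theorem taylorProj_one : taylorProj x₀ (1 : Multivector U) = 1 := by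
  rw [Algebra.TensorProduct.one_def, ← coordWord_nil, taylorProj_tmul_coordWord]
  change taylorPart x₀ 0 1 ⊗ₜ[ℝ] _ = _
  rw [taylorPart_zero]
  change algebraMap ℝ (Smooth U) 1 ⊗ₜ[ℝ] _ = _
  rw [map_one]

variable {x₀} (hx₀ : (x₀ : ℝ × (Fin m → ℝ)).2 = 0)

include hx₀

theorem taylorProj_linearField_mul (i j : Fin m) (x : Multivector U) :
    taylorProj x₀ (linearField U i j * x) = linearField U i j * taylorProj x₀ x := by
  induction x using multivector_induction with
  | h0 => simp
  | hadd x y hx hy => simp only [mul_add, map_add, hx, hy]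
  | hword f l =>
    rw [taylorProj_tmul_coordWord, linearField_mul_tmul, linearField_mul_tmul,
      ← coordBasis_inr (m := m) j, ← coordWord_cons, taylorProj_tmul_coordWord, height_cons_inr,
      taylorPart_uCoord_mul hx₀]

theorem taylorProj_eulerField_mul (x : Multivector U) :
    taylorProj x₀ (eulerField U * x) = eulerField U * taylorProj x₀ x := by
  simp only [eulerField, Finset.sum_mul, map_sum, taylorProj_linearField_mul hx₀]

/-- On a word of height k, L is E - k on the coefficient, and E acts on the Taylor part of degree k
as k. -/
theorem taylorProj_lieEuler (x : Multivector U) : taylorProj x₀ (lieEuler U x) = 0 := by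
  induction x using multivector_induction with
  | h0 => simp
  | hadd x y hx hy => simp only [map_add, hx, hy, add_zero]
  | hword f l =>
    rw [lieEuler_tmul_coordWord, taylorProj_tmul_coordWord, map_sub, map_smul,
      taylorPart_eulerDeriv hx₀, sub_self, TensorProduct.zero_tmul]

/-- It suffices to treat generators: ∂_t changes neither height nor coefficient, and u_i ∂_{u_j}
raises both the height and the Taylor degree by one. -/
theorem taylorProj_mul {a : Multivector U} (ha : a ∈ linearFieldAlgebra U) (x : Multivector U) :
    taylorProj x₀ (a * x) = a * taylorProj x₀ x := by
  induction ha using Algebra.adjoin_induction generalizing x with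
  | mem a ha =>
    have ha' : a ∈ linearFieldSpan U := ha
    clear ha
    induction ha' using Submodule.span_induction with
    | mem a ha =>
      rcases ha with rfl | ⟨p, rfl⟩
      · exact taylorProj_partialT_mul x₀ x
      · exact taylorProj_linearField_mul hx₀ _ _ x
    | zero => simp
    | add a b _ _ h1 h2 => rw [add_mul, map_add, h1, h2, add_mul]
    | smul r a _ h => rw [smul_mul_assoc, map_smul, h, smul_mul_assoc]
  | algebraMap r => rw [← Algebra.smul_def, map_smul, Algebra.smul_def]
  | add a b _ _ ha hb => rw [add_mul, map_add, ha, hb, add_mul]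
  | mul a b _ _ ha hb => rw [mul_assoc, ha, hb, mul_assoc]

theorem taylorProj_eq_self {a : Multivector U} (ha : a ∈ linearFieldAlgebra U) :
    taylorProj x₀ a = a := by
  rw [← mul_one a, taylorProj_mul hx₀ ha, taylorProj_one]

/-- The term ∂_t ∧ L x is killed, and the projection commutes with E ∧. This one formula yields both
the kernel and the representatives. -/
theorem taylorProj_bookDiff (x : Multivector U) : taylorProj x₀ (bookDiff U x)
    = -(eulerField U * taylorProj x₀ (coeffDeriv U (1, 0) x)) := by
  rw [bookDiff_apply, map_sub, taylorProj_partialT_mul, taylorProj_lieEuler hx₀,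
    taylorProj_eulerField_mul hx₀, mul_zero, zero_sub]

end Projection

/-! ### Cohomology classes and the kernel of the natural map. -/

theorem exists_bookDiff_eq_eulerField : ∃ y, bookDiff U y = eulerField U := by
  let t : Smooth U := Smooth.ofContDiffOn Prod.fst contDiff_fst.contDiffOn
  have ht : ∀ v : ℝ × (Fin m → ℝ), dirDeriv U v t = algebraMap ℝ (Smooth U) v.1 := fun v =>
    Smooth.ext fun x => by
      rw [Smooth.dirDeriv_ofContDiffOn, fderiv_fst]
      rfl
  have hE : eulerDeriv U t = 0 := by
    rw [eulerDeriv_apply]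
    exact Finset.sum_eq_zero fun i _ => by rw [ht, map_zero, mul_zero]
  -- The function t is killed by E and has D t = 1, so d t = -E.
  refine ⟨-(t ⊗ₜ 1), ?_⟩
  rw [map_neg, bookDiff_apply, lieEuler_tmul, hE, verticalNumber_one, coeffDeriv_tmul, ht, map_one,
    TensorProduct.zero_tmul, TensorProduct.tmul_zero, ← Algebra.TensorProduct.one_def]
  simp

theorem mk_eq_mk_iff (x y : closedMultivectors (coordBasis m) (bookBivector_mem U)) :
    Ideal.Quotient.mk (exactMultivectors (coordBasis m) (bookBivector_mem U)) x
      = Ideal.Quotient.mk (exactMultivectors (coordBasis m) (bookBivector_mem U)) y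
      ↔ ∃ z, bookDiff U z = (x : Multivector U) - y :=
  Ideal.Quotient.eq

theorem naturalMap_eq_mk_iff (a : linearFieldAlgebra U)
    (x : closedMultivectors (coordBasis m) (bookBivector_mem U)) :
    naturalMap U a
      = Ideal.Quotient.mk (exactMultivectors (coordBasis m) (bookBivector_mem U)) x
      ↔ ∃ z, bookDiff U z = (a : Multivector U) - x :=
  mk_eq_mk_iff (Subalgebra.inclusion (linearFieldAlgebra_le U) a) x

theorem naturalMap_eq_zero_iff (a : linearFieldAlgebra U) :
    naturalMap U a = 0 ↔ ∃ z, bookDiff U z = (a : Multivector U) := by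
  have h := naturalMap_eq_mk_iff a 0
  rw [map_zero, ZeroMemClass.coe_zero, sub_zero] at h
  exact h

theorem naturalMap_eulerElement : naturalMap U (eulerElement U) = 0 :=
  (naturalMap_eq_zero_iff _).mpr exists_bookDiff_eq_eulerField

/-- The element of `linearFieldAlgebra` that represents the class of a closed multivector field. -/
theorem naturalMap_taylorProj {x₀ : U} (hx₀ : (x₀ : ℝ × (Fin m → ℝ)).2 = 0) (hm : m ≠ 0)
    (hfib : ∀ u : Fin m → ℝ, IsPreconnected {x : ℝ × (Fin m → ℝ) | x ∈ U ∧ x.2 = u})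
    (hstar : StarConvex ℝ (0 : Fin m → ℝ) (Prod.snd '' (U : Set (ℝ × (Fin m → ℝ)))))
    (x : closedMultivectors (coordBasis m) (bookBivector_mem U)) :
    naturalMap U ⟨taylorProj x₀ x, taylorProj_mem x₀ x⟩
      = Ideal.Quotient.mk (exactMultivectors (coordBasis m) (bookBivector_mem U)) x := by
  obtain ⟨x, hx⟩ := x
  obtain ⟨p, hp, y, rfl⟩ := exists_linearFieldAlgebra_add hfib hstar hm hx
  -- The projection of p + d y differs from p by a multiple of E, whose class is zero. Unlike p, it
  -- visibly has the degree of the given field.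
  have h : (⟨taylorProj x₀ (p + bookDiff U y), taylorProj_mem x₀ _⟩ : linearFieldAlgebra U)
      = ⟨p, hp⟩ - eulerElement U
        * ⟨taylorProj x₀ (coeffDeriv U (1, 0) y), taylorProj_mem x₀ _⟩ := by
    refine Subtype.ext ?_
    change taylorProj x₀ (p + bookDiff U y) = p - eulerField U * taylorProj x₀ _
    rw [map_add, taylorProj_eq_self hx₀ hp, taylorProj_bookDiff hx₀, sub_eq_add_neg]
  change naturalMap U ⟨taylorProj x₀ (p + bookDiff U y), _⟩ = _
  rw [h, map_sub, map_mul, naturalMap_eulerElement, zero_mul, sub_zero, naturalMap_eq_mk_iff]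
  refine ⟨-y, ?_⟩
  rw [map_neg]
  change -bookDiff U y = p - (p + bookDiff U y)
  abel

theorem ker_naturalMap {x₀ : U} (hx₀ : (x₀ : ℝ × (Fin m → ℝ)).2 = 0) :
    TwoSidedIdeal.ker (naturalMap U) = TwoSidedIdeal.span {eulerElement U} := by
  refine le_antisymm (fun a ha => ?_) ?_
  · rw [TwoSidedIdeal.mem_ker, naturalMap_eq_zero_iff] at ha
    obtain ⟨y, hy⟩ := ha
    -- The projection fixes a and sends d y to -E ∧ T (D y), which exhibits a as a multiple of E.
    have h : a = -(eulerElement U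
        * ⟨taylorProj x₀ (coeffDeriv U (1, 0) y), taylorProj_mem x₀ _⟩) := by
      refine Subtype.ext ?_
      rw [← taylorProj_eq_self hx₀ a.2, ← hy]
      exact taylorProj_bookDiff hx₀ y
    rw [h]
    exact neg_mem (TwoSidedIdeal.mul_mem_right _ _ _
      (TwoSidedIdeal.subset_span (Set.mem_singleton _)))
  · rw [TwoSidedIdeal.span_le, Set.singleton_subset_iff, SetLike.mem_coe, TwoSidedIdeal.mem_ker]
    exact naturalMap_eulerElement

end Words

end BookPoisson

end

/-! ### The main theorem. -/

theorem theorem2p2 (n : ℕ) (hn : 2 ≤ n) (U : TopologicalSpace.Opens (ℝ × (Fin (n - 1) → ℝ)))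
    (hne : (U : Set (ℝ × (Fin (n - 1) → ℝ))).Nonempty)
    (hfib : ∀ u : Fin (n - 1) → ℝ, IsPreconnected {x : ℝ × (Fin (n - 1) → ℝ) | x ∈ U ∧ x.2 = u})
    (hstar : StarConvex ℝ (0 : Fin (n - 1) → ℝ)
      (Prod.snd '' (U : Set (ℝ × (Fin (n - 1) → ℝ))))) :
    Function.Surjective (BookPoisson.naturalMap U) ∧
      TwoSidedIdeal.ker (BookPoisson.naturalMap U) = TwoSidedIdeal.span {BookPoisson.eulerElement U} ∧
      (∃ φ : (TwoSidedIdeal.span {BookPoisson.eulerElement U}).ringCon.Quotient ≃+*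
          BookPoisson.BookCohomology U,
        ∀ a : BookPoisson.linearFieldAlgebra U,
          φ ((TwoSidedIdeal.span {BookPoisson.eulerElement U}).ringCon.mk' a)
            = BookPoisson.naturalMap U a) ∧
      ∀ k : ℕ, (BookPoisson.linearFieldAlgebraOfDegree U k).map (BookPoisson.naturalMap U).toLinearMap
        = BookPoisson.bookCohomologyOfDegree U k := by
  have hm : n - 1 ≠ 0 := by omega
  obtain ⟨y, hy⟩ := hne
  -- A nonempty set that is star-shaped about 0 contains 0, so U has a point over u = 0, the base
  -- point for Taylor parts.
  obtain ⟨x, hx, hx0⟩ := hstar.mem ⟨_, y, hy, rfl⟩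
  have hx₀ : ((⟨x, hx⟩ : U) : ℝ × (Fin (n - 1) → ℝ)).2 = 0 := hx0
  have hrep := BookPoisson.naturalMap_taylorProj hx₀ hm hfib hstar
  have hsurj : Function.Surjective (BookPoisson.naturalMap U) := by
    intro c
    obtain ⟨z, rfl⟩ := Ideal.Quotient.mk_surjective c
    exact ⟨_, hrep z⟩
  have hker := BookPoisson.ker_naturalMap hx₀
  refine ⟨hsurj, hker, ?_, fun k => le_antisymm ?_ ?_⟩
  · exact BookPoisson.exists_ringEquiv_of_ker_eq (BookPoisson.naturalMap U) hsurj hker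
  · rintro _ ⟨a, ha, rfl⟩
    exact ⟨Subalgebra.inclusion (BookPoisson.linearFieldAlgebra_le U) a, ha, rfl⟩
  · rintro _ ⟨z, hz, rfl⟩
    -- Surjectivity in degree k: the Taylor projection of a closed k-vector field is again of degree
    -- k and has the same class.
    exact ⟨_, BookPoisson.taylorProj_mem_multivectorsOfDegree ⟨x, hx⟩ hz, hrep z⟩
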